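/- **Conventions.** All graphs are finite; $|H|$ is the number of vertices of $H$; paths may be trivial (a single vertex) and are directed. For sets $X,Y$ of vertices with $|X|=|Y|$, an $X$–$Y$ linkage is a set of $|X|$ disjoint $X$–$Y$ paths (an $X$–$Y$ path has precisely its first vertex in $X$ and precisely its last vertex in $Y$). A set of disjoint paths is identified with its union. For a subgraph $S$ of a graph $H$, an $S$-*bridge in $H$* is either a single edge of $H-E(S)$ with both ends in $S$ (trivial), or consists of a component $C$ of $H-V(S)$ and all edges of $H$ with an end in $C$, with their ends (non-trivial); it *attaches* to $S'\subseteq S$ if it has a vertex of $S$ in $S'$. A linkage $\mathcal R$ in $H$ is *$p$-attached* if its paths are induced in $H$ and, whenever a non-trivial $\mathcal R$-bridge in $H$ attaches to a non-trivial path $R\in\mathcal R$, it attaches to another non-trivial path of $\mathcal R$ or there are at least $p-2$ trivial paths $R'\in\mathcal R$ such that some $\mathcal R$-bridge in $H$ attaches to $R$ and $R'$. For an enumerated linkage $\mathcal R=(R_1,\dots,R_q)$ in $G$ and $H\subseteq G$, the *bridge graph* $B(H,\mathcal R)$ has vertex set $\{1,\dots,q\}$, distinct $\alpha,\beta$ being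 adjacent iff some $\mathcal R$-bridge in $G$ contained in $H$ attaches to $R_\alpha$ and $R_\beta$ (it *realises* $\alpha\beta$). **Decompositions.** Let $\mathcal W=(W_0,\dots,W_l)$ be a tuple of subsets of $V(G)$ (the bags), with adhesion sets $W_{i-1}\cap W_i$ ($1\le i\le l$) and inner bags $W_1,\dots,W_{l-1}$; the left and right adhesion sets of $W_i$ are $W_{i-1}\cap W_i$ and $W_i\cap W_{i+1}$. It is a *slim decomposition* of $G$ of adhesion $q$ if the bags cover $V(G)$ and every edge lies in a bag, $W_i\cap W_k\subseteq W_j$ for $i\le j\le k$, all adhesion sets have size $q$, no bag contains another, and there is a linkage from the first to the last adhesion set. Such a linkage with an enumeration $P_1,\dots,P_q$ of its paths is a *foundational linkage*; all other foundational linkages $\mathcal Q=(Q_1,\dots,Q_q)$ are enumerated so that $Q_\alpha$ and $P_\alpha$ have the same first vertex. Put $\Gamma=\Gamma(\mathcal W,\mathcal P)=B(G[W_1\cup\dots\cup W_{l-1}],\mathcal P)$, $\lambda=\{\alpha: P_\alpha\text{ non-trivial}\}$ and $\theta=\{\alpha:P_\alpha\text{ trivial}\}$. The pair $(\mathcal W,\mathcal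 P)$ is *regular of attachedness $p$* if for all inner bags $W,W'$: $\mathcal P[W]$ is $p$-attached in $G[W]$; $P_\alpha$ is trivial whenever $P_\alpha[W]$ is; and $B(G[W],\mathcal P)=B(G[W'],\mathcal P)$. It is *stable* if moreover, for every linkage $\mathcal R$ from the left to the right adhesion set of an inner bag $W$, enumerated so that $R_\alpha$ starts on $P_\alpha$, the permutation $\pi$ for which $R_\alpha$ ends on $P_{\pi(\alpha)}$ is an automorphism of $\Gamma$, and every edge of $B(G[W],\mathcal R)$ with at least one end in $\lambda$ is an edge of $\Gamma$. For $\Gamma'\subseteq\Gamma$ let $G_{\Gamma'}^{\mathcal Q}$ be obtained from the union of $\mathcal Q$ and those $\mathcal Q$-bridges in inner bags that realise an edge of $\Gamma'$, or attach to some $Q_\alpha$ with $\alpha\in V(\Gamma')\cap\lambda$ but to no $Q_\beta$ with $\beta\in\lambda\setminus V(\Gamma')$, by deleting all $Q_\alpha$ with $\alpha\notin V(\Gamma')$. For a set $U$ of indices put $G_U^{\mathcal Q}=G_{\Gamma[U]}^{\mathcal Q}$, and let $G_\lambda=G_\lambda^{\mathcal P}$. For $U\subseteq\lambda$, $\mathcal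 Q$ is *$U$-compressed* if there is no vertex $v$ of $G_U^{\mathcal Q}$ that has a neighbour in $G_\lambda-G_U^{\mathcal Q}$ and for which $G_U^{\mathcal Q}-v$ contains $|U|$ disjoint paths from the first to the last adhesion set. **Lemma.** Let $(\mathcal W,\mathcal P)$ be a stable regular decomposition of length $l\ge3$ and attachedness $p$ of a $p$-connected graph $G$. Let $D$ be a block (maximal connected subgraph without a cut-vertex) of $\Gamma[\lambda]$, let $\kappa$ be the set of cut-vertices of $\Gamma[\lambda]$ that are in $D$, and let $N(D)$ be the neighbourhood of $V(D)$ in $\Gamma$. Let $\mathcal Q$ be a $V(D)$-compressed foundational linkage and let $V$ be the set of all inner vertices of paths $Q_\alpha$, $\alpha\in\kappa$, that have degree at least $3$ in $G_D^{\mathcal Q}$. Then: (i) $2|D|+|N(D)\cap\theta|\ge p$, or $V(G_D^{\mathcal Q})=\bigcup_{\alpha\in V(D)}V(Q_\alpha)$ and $\kappa\ne\emptyset$. (ii) $2|D|+|N(D)|\ge p$, or there is $\alpha\in\kappa$ such that $|Q_\beta|\le|V\cap V(Q_\alpha)|+1$ for all $\beta\in V(D)\setminus\kappa$. -/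

import Mathlib

namespace StableDecomp

variable {V : Type*}

/-! ### Connectivity, cut-vertices and blocks -/

/-- `G` is `k`-connected: it has more than `k` vertices, and deleting fewer than `k` vertices
never disconnects it. -/
def IsKConnected (G : SimpleGraph V) (k : ℕ) : Prop :=
  k < Nat.card V ∧ ∀ X : Set V, X.ncard < k → (G.induce Xᶜ).Connected

/-- `x` is a cut-vertex of `H`: it separates two other vertices of the same component of `H`. -/
def IsCutVertex {G : SimpleGraph V} (H : G.Subgraph) (x : V) : Prop :=
  x ∈ H.verts ∧ ∃ u ∈ H.verts, ∃ v ∈ H.verts, u ≠ x ∧ v ≠ x ∧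
    H.spanningCoe.Reachable u v ∧ ¬ (H.deleteVerts {x}).spanningCoe.Reachable u v

/-- `D` is a block of `H`: a maximal (non-empty) connected subgraph of `H` that has no cut-vertex
of its own. -/
def IsBlock {G : SimpleGraph V} (H D : G.Subgraph) : Prop :=
  Maximal (fun D' : G.Subgraph => D' ≤ H ∧ D'.Connected ∧ ∀ x, ¬ IsCutVertex D' x) D

/-! ### Paths and linkages -/

/-- A path of `G` together with its direction. Trivial (one-vertex) paths are allowed. -/
structure DPath (G : SimpleGraph V) where
  fst : V
  lst : V
  walk : G.Walk fst lst
  isPath : walk.IsPath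

/-- The path as a subgraph of `G`. -/
def DPath.graph {G : SimpleGraph V} (P : DPath G) : G.Subgraph := P.walk.toSubgraph

/-- The set of vertices of the path. -/
def DPath.verts {G : SimpleGraph V} (P : DPath G) : Set V := P.graph.verts

/-- The set of inner vertices of the path. -/
def DPath.inner {G : SimpleGraph V} (P : DPath G) : Set V := P.verts \ {P.fst, P.lst}

/-- `P` is an `X`--`Y` path: precisely its first vertex is in `X` and precisely its last vertex
is in `Y`. -/
def DPath.IsBetween {G : SimpleGraph V} (P : DPath G) (X Y : Set V) : Prop :=
  P.verts ∩ X = {P.fst} ∧ P.verts ∩ Y = {P.lst}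

/-- The paths `R i` are pairwise (vertex-)disjoint. -/
def PairwiseDisjointPaths {G : SimpleGraph V} {ι : Type*} (R : ι → DPath G) : Prop :=
  ∀ i j, i ≠ j → Disjoint (R i).verts (R j).verts

/-- `R` is an enumerated `X`--`Y` linkage: `|X| = |Y|` many disjoint `X`--`Y` paths. -/
def IsLinkage {G : SimpleGraph V} {ι : Type*} (X Y : Set V) (R : ι → DPath G) : Prop :=
  X.ncard = Nat.card ι ∧ Y.ncard = Nat.card ι ∧ (∀ i, (R i).IsBetween X Y) ∧
    PairwiseDisjointPaths R

/-! ### Bridges -/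

/-- `G[U]` as a subgraph of `G`. -/
def inducedOn (G : SimpleGraph V) (U : Set V) : G.Subgraph := (⊤ : G.Subgraph).induce U

/-- The vertex set of the component of `H - S` that contains `x`
(used for vertices `x` of `H - S` only). -/
def componentAvoiding {G : SimpleGraph V} (H S : G.Subgraph) (x : V) : Set V :=
  {y | (H.deleteVerts S.verts).spanningCoe.Reachable x y}

/-- `B` is a trivial `S`-bridge in `H`: a single edge of `H` that is not in `S` but has both ends
in `S`. -/
def IsTrivialBridge {G : SimpleGraph V} (H S B : G.Subgraph) : Prop :=
  ∃ (u v : V) (h : H.Adj u v), u ∈ S.verts ∧ v ∈ S.verts ∧ ¬ S.Adj u v ∧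
    B = G.subgraphOfAdj (H.adj_sub h)

/-- `B` is a non-trivial `S`-bridge in `H`: it consists of a component `C` of `H - S` and of all
edges of `H` with at least one end in `C` (and the ends of these edges). -/
def IsNontrivialBridge {G : SimpleGraph V} (H S B : G.Subgraph) : Prop :=
  ∃ x ∈ H.verts \ S.verts,
    B.verts = componentAvoiding H S x ∪ {v | ∃ c ∈ componentAvoiding H S x, H.Adj c v} ∧
    ∀ u v, B.Adj u v ↔
      H.Adj u v ∧ (u ∈ componentAvoiding H S x ∨ v ∈ componentAvoiding H S x)

/-- `B` is an `S`-bridge in `H`. -/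
def IsBridge {G : SimpleGraph V} (H S B : G.Subgraph) : Prop :=
  IsTrivialBridge H S B ∨ IsNontrivialBridge H S B

/-- The bridge `B` attaches to the subgraph `S'` of `S`: it has an attachment (a vertex of `B`
in `S`) that lies in `S'`. -/
def Attaches {G : SimpleGraph V} (B S' : G.Subgraph) : Prop :=
  (B.verts ∩ S'.verts).Nonempty

/-- The bridge graph `B(H, R)` of the enumerated linkage `R`: distinct `α`, `β` are adjacent if
`H` contains an `R`-bridge that attaches to `R α` and to `R β`. -/
def bridgeGraph {G : SimpleGraph V} {ι : Type*} (H : G.Subgraph) (R : ι → DPath G) :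
    SimpleGraph ι where
  Adj α β := α ≠ β ∧ ∃ B : G.Subgraph, IsBridge ⊤ (⨆ i, (R i).graph) B ∧ B ≤ H ∧
    Attaches B (R α).graph ∧ Attaches B (R β).graph
  symm := ⟨fun _ _ h => ⟨h.1.symm, h.2.imp fun _ hB => ⟨hB.1, hB.2.1, hB.2.2.2, hB.2.2.1⟩⟩⟩
  loopless := ⟨fun _ h => h.1 rfl⟩

/-- A path, given as a subgraph, is trivial if it has just one vertex. -/
def IsTrivialPath {G : SimpleGraph V} (S : G.Subgraph) : Prop := S.verts.ncard = 1

/-- The linkage with the paths `R i` (given as subgraphs of `H`) is `p`-attached in `H`. The bound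
"at least `p - 2`" is written without subtraction. -/
def IsAttached {G : SimpleGraph V} {ι : Type*} (H : G.Subgraph) (R : ι → G.Subgraph) (p : ℕ) :
    Prop :=
  (∀ i, ∀ u ∈ (R i).verts, ∀ v ∈ (R i).verts, H.Adj u v → (R i).Adj u v) ∧
  ∀ B : G.Subgraph, IsNontrivialBridge H (⨆ i, R i) B →
    ∀ i, ¬ IsTrivialPath (R i) → Attaches B (R i) →
      (∃ j, j ≠ i ∧ ¬ IsTrivialPath (R j) ∧ Attaches B (R j)) ∨
      p ≤ {j | IsTrivialPath (R j) ∧ ∃ B' : G.Subgraph, IsBridge H (⨆ i, R i) B' ∧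
        Attaches B' (R i) ∧ Attaches B' (R j)}.ncard + 2

/-! ### Slim, regular and stable decompositions

A tuple `(W 0, …, W l)` is given by its length `l` and a map `W : ℕ → Set V` of which only the
values at `0, …, l` are used. The inner bags are the `W i` with `1 ≤ i < l`. -/

/-- The adhesion set `W i ∩ W (i + 1)`: it is the right adhesion set of `W i` and the left
adhesion set of `W (i + 1)`. The adhesion sets are `adh W 0, …, adh W (l - 1)`. -/
def adh (W : ℕ → Set V) (i : ℕ) : Set V := W i ∩ W (i + 1)

/-- `P` is an (enumerated) foundational linkage for `(W 0, …, W l)`, that is, a linkage from the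
first to the last adhesion set. -/
def IsFoundational {G : SimpleGraph V} {q : ℕ} (W : ℕ → Set V) (l : ℕ) (P : Fin q → DPath G) :
    Prop :=
  IsLinkage (adh W 0) (adh W (l - 1)) P

/-- `(W 0, …, W l)` is a slim decomposition of `G` of adhesion `q`. -/
structure IsSlim (G : SimpleGraph V) (W : ℕ → Set V) (l q : ℕ) : Prop where
  cover : ∀ v, ∃ i ≤ l, v ∈ W i
  cover_edge : ∀ u v, G.Adj u v → ∃ i ≤ l, u ∈ W i ∧ v ∈ W i
  interval : ∀ i j k, i ≤ j → j ≤ k → k ≤ l → W i ∩ W k ⊆ W j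
  adhesion : ∀ i < l, (adh W i).ncard = q
  antichain : ∀ i ≤ l, ∀ j ≤ l, i ≠ j → ¬ W i ⊆ W j
  linked : ∃ P : Fin q → DPath G, IsFoundational W l P

/-- The union of the inner bags. -/
def innerUnion (W : ℕ → Set V) (l : ℕ) : Set V := ⋃ i ∈ Set.Ico 1 l, W i

/-- The auxiliary graph `Γ(W, P)`. -/
def auxGraph {G : SimpleGraph V} {q : ℕ} (W : ℕ → Set V) (l : ℕ) (P : Fin q → DPath G) :
    SimpleGraph (Fin q) :=
  bridgeGraph (inducedOn G (innerUnion W l)) P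

/-- `λ`, the set of indices of non-trivial paths. -/
def lam {G : SimpleGraph V} {q : ℕ} (P : Fin q → DPath G) : Set (Fin q) :=
  {α | ¬ IsTrivialPath (P α).graph}

/-- `θ`, the set of indices of trivial paths. -/
def theta {G : SimpleGraph V} {q : ℕ} (P : Fin q → DPath G) : Set (Fin q) :=
  {α | IsTrivialPath (P α).graph}

/-- `P[U]`, the paths of `P` restricted to `G[U]`. -/
def restrict {G : SimpleGraph V} {q : ℕ} (P : Fin q → DPath G) (U : Set V) :
    Fin q → G.Subgraph :=
  fun α => (P α).graph ⊓ inducedOn G U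

/-- `(W, P)` is a regular decomposition of `G` of length `l`, adhesion `q` and attachedness `p`. -/
structure IsRegular (G : SimpleGraph V) {q : ℕ} (W : ℕ → Set V) (l : ℕ) (P : Fin q → DPath G)
    (p : ℕ) : Prop where
  slim : IsSlim G W l q
  foundational : IsFoundational W l P
  attached : ∀ i, 1 ≤ i → i < l → IsAttached (inducedOn G (W i)) (restrict P (W i)) p
  trivial_of_restrict : ∀ α i, 1 ≤ i → i < l → IsTrivialPath (restrict P (W i) α) →
    IsTrivialPath (P α).graph
  bridges : ∀ α β, ∀ i, 1 ≤ i → i < l → ∀ j, 1 ≤ j → j < l →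
    (bridgeGraph (inducedOn G (W i)) P).Adj α β → (bridgeGraph (inducedOn G (W j)) P).Adj α β

/-- `Q`, a linkage from the left to the right adhesion set of the inner bag `W i`, carries the
enumeration induced by `P`: the path `Q α` starts in the left `α`-vertex of `W i`. -/
def IsBagLinkage {G : SimpleGraph V} {q : ℕ} (W : ℕ → Set V) (P : Fin q → DPath G) (i : ℕ)
    (Q : Fin q → DPath G) : Prop :=
  IsLinkage (adh W (i - 1)) (adh W i) Q ∧ ∀ α, (Q α).fst ∈ (P α).verts

/-- `π` is the induced permutation of `Q`: the path `Q α` ends in the right `π α`-vertex. -/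
def IsInducedPerm {G : SimpleGraph V} {q : ℕ} (P Q : Fin q → DPath G)
    (π : Equiv.Perm (Fin q)) : Prop :=
  ∀ α, (Q α).lst ∈ (P (π α)).verts

/-- `(W, P)` is a stable regular decomposition of `G` of length `l`, adhesion `q` and
attachedness `p`. -/
structure IsStable (G : SimpleGraph V) {q : ℕ} (W : ℕ → Set V) (l : ℕ) (P : Fin q → DPath G)
    (p : ℕ) : Prop extends IsRegular G W l P p where
  no_twist : ∀ i, 1 ≤ i → i < l → ∀ Q : Fin q → DPath G, IsBagLinkage W P i Q →
    ∀ π : Equiv.Perm (Fin q), IsInducedPerm P Q π →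
      ∀ α β, (auxGraph W l P).Adj (π α) (π β) ↔ (auxGraph W l P).Adj α β
  no_bridging : ∀ i, 1 ≤ i → i < l → ∀ Q : Fin q → DPath G, IsBagLinkage W P i Q →
    ∀ α β, (α ∈ lam P ∨ β ∈ lam P) →
      (bridgeGraph (inducedOn G (W i)) Q).Adj α β → (auxGraph W l P).Adj α β

/-- A foundational linkage whose enumeration agrees with that of `P` on the first adhesion set. -/
def IsFoundationalLike {G : SimpleGraph V} {q : ℕ} (W : ℕ → Set V) (l : ℕ)
    (P Q : Fin q → DPath G) : Prop :=
  IsFoundational W l Q ∧ ∀ α, (Q α).fst = (P α).fst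

/-! ### The graphs `G_Γ^Q` and compressed linkages -/

/-- The `Q`-bridges in inner bags that realise an edge of `Γ'`, or attach to a path of
`Q_{V(Γ') ∩ λ}` but to no path of `Q_{λ ∖ V(Γ')}`. -/
def selectedBridges {G : SimpleGraph V} {q : ℕ} (W : ℕ → Set V) (l : ℕ) (P Q : Fin q → DPath G)
    (Γ' : (auxGraph W l P).Subgraph) : Set G.Subgraph :=
  {B | IsBridge ⊤ (⨆ α, (Q α).graph) B ∧ (∃ i, 1 ≤ i ∧ i < l ∧ B ≤ inducedOn G (W i)) ∧
    ((∃ α β, Γ'.Adj α β ∧ Attaches B (Q α).graph ∧ Attaches B (Q β).graph) ∨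
     ((∃ α ∈ Γ'.verts ∩ lam P, Attaches B (Q α).graph) ∧
      ∀ β ∈ lam P \ Γ'.verts, ¬ Attaches B (Q β).graph))}

/-- The graph `G_{Γ'}^Q` for a subgraph `Γ'` of the auxiliary graph `Γ(W, P)`: the union of `Q` and
the selected bridges, minus the paths of `Q` that do not belong to `Q_{V(Γ')}`. -/
def part {G : SimpleGraph V} {q : ℕ} (W : ℕ → Set V) (l : ℕ) (P Q : Fin q → DPath G)
    (Γ' : (auxGraph W l P).Subgraph) : G.Subgraph :=
  ((⨆ α, (Q α).graph) ⊔ sSup (selectedBridges W l P Q Γ')).deleteVerts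
    (⋃ α ∈ (Γ'.verts)ᶜ, (Q α).verts)

/-- The graph `G_U^Q := G_{Γ(W, P)[U]}^Q` for a set `U` of indices. -/
def partOn {G : SimpleGraph V} {q : ℕ} (W : ℕ → Set V) (l : ℕ) (P Q : Fin q → DPath G)
    (U : Set (Fin q)) : G.Subgraph :=
  part W l P Q (inducedOn (auxGraph W l P) U)

/-- `Q` is compressed to `U`: no vertex `v` of `G_U^Q` has a neighbour in `G_λ - G_U^Q` (where
`G_λ := G_λ^P`) and is such that `G_U^Q - v` contains `|U|` disjoint paths from the first to the
last adhesion set. -/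
def IsCompressed {G : SimpleGraph V} {q : ℕ} (W : ℕ → Set V) (l : ℕ) (P Q : Fin q → DPath G)
    (U : Set (Fin q)) : Prop :=
  ¬ ∃ v ∈ (partOn W l P Q U).verts,
    (∃ R : U → DPath G, PairwiseDisjointPaths R ∧
      ∀ α, (R α).IsBetween (adh W 0) (adh W (l - 1)) ∧
        (R α).graph ≤ (partOn W l P Q U).deleteVerts {v}) ∧
    ∃ w ∈ (partOn W l P P (lam P)).verts \ (partOn W l P Q U).verts, G.Adj v w

/-- `N(D)`, the neighbourhood in `Γ` of the vertex set of the subgraph `D`. -/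
def nbhd {ι : Type*} {Γ : SimpleGraph ι} (D : Γ.Subgraph) : Set ι :=
  {β | β ∉ D.verts ∧ ∃ α ∈ D.verts, Γ.Adj α β}

/-- `κ`, the set of all cut-vertices of `Γ[L]` that lie in `D`. -/
def cutIn {ι : Type*} {Γ : SimpleGraph ι} (L : Set ι) (D : Γ.Subgraph) : Set ι :=
  {α | α ∈ D.verts ∧ IsCutVertex (inducedOn Γ L) α}

/-- The set of all inner vertices of paths `Q α` with `α ∈ K` that have degree at least `3`
in `H`. -/
def highDegree {G : SimpleGraph V} {q : ℕ} (Q : Fin q → DPath G) (K : Set (Fin q))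
    (H : G.Subgraph) : Set V :=
  {v | (∃ α ∈ K, v ∈ (Q α).inner) ∧ 3 ≤ (H.neighborSet v).ncard}

end StableDecomp

/-! Write `H` for `G_D^Q` and `d` for `|D|`. The `d` disjoint paths `Q α`, `α ∈ D`, cross `H` from
the first adhesion set `A` to the last adhesion set `B`, so every separation of `H` with `A` on the
left and `B` on the right has order at least `d`. Those of order `d` are called tight; their
separators contain exactly one vertex of each of these paths and no others (`IsTight.transversal`).
By submodularity they are closed under union of left sides (`IsTight.join`), and symmetrically for
right sides. So for a vertex `x` outside `A ∪ B` there are extremal tight separations on both sides,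
and the region of `x`, the set of vertices that no tight separation distinguishes from `x`, is
bounded in `H` by at most `2d` vertices (`exists_boundary`).

Outside `H`, a vertex of `H` off the outer bags can only have neighbours on trivial paths in `N(D)`,
or in `G_λ - H`; the latter happens only on paths of cut-vertices, since `D` is a block and
stability keeps bridges of `Q` on edges of `Γ` (`IsBlock.adj_part`). By Menger's theorem,
compressedness says that a vertex with a neighbour in `G_λ - H` is on a tight separator.

For (i), suppose `2d + |N(D) ∩ θ| < p`. A vertex on no tight separator would have a region without
neighbours in `G_λ - H`, cut off by fewer than `p` vertices. So every vertex of `H` is on a tight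
separator and hence on a path. If `κ` were empty, then `A`, `B` and the trivial neighbours would
already cut off the inside of `H`.

For (ii), suppose `2d + |N(D)| < p`, and let `x` be an inner vertex of `Q β` with `β ∉ κ`. Delete
the paths of `κ` from the region of `x`. The rest is cut off by the `2d` boundary vertices, the
trivial neighbours and those vertices of degree at least 3 on paths of `κ` that lie in the region.
As `|κ| ≤ |N(D) ∩ λ|` (`ncard_cutIn_le`), `p`-connectivity forces more than `|κ|` such vertices.
Regions of distinct inner vertices of `Q β` are disjoint, because a tight separator meets `Q β` only
once. Double counting the vertices of high degree then bounds `|Q β|`. -/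

namespace StableDecomp

variable {V : Type*}

/-! ### Menger's theorem -/

/-- The vertices that can be reached from `A` by walks of `G` avoiding `S`. -/
def reachAvoid (G : SimpleGraph V) (A S : Set V) : Set V :=
  {v | ∃ a ∈ A, ∃ p : G.Walk a v, ∀ w ∈ p.support, w ∉ S}

/-- Every walk from `A` to `B` meets `S`. -/
def Separates (G : SimpleGraph V) (A B S : Set V) : Prop :=
  ∀ b ∈ B, b ∉ reachAvoid G A S

section Reach

variable {G : SimpleGraph V} {A B S : Set V}

lemma notMem_of_mem_reachAvoid {v : V} (h : v ∈ reachAvoid G A S) : v ∉ S := by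
  obtain ⟨a, _, p, hp⟩ := h
  exact hp _ p.end_mem_support

lemma mem_reachAvoid_of_mem {a : V} (ha : a ∈ A) (hS : a ∉ S) : a ∈ reachAvoid G A S :=
  ⟨a, ha, .nil, by simpa using hS⟩

lemma mem_reachAvoid_of_adj {v w : V} (hv : v ∈ reachAvoid G A S) (h : G.Adj v w)
    (hw : w ∉ S) : w ∈ reachAvoid G A S := by
  obtain ⟨a, ha, p, hp⟩ := hv
  refine ⟨a, ha, p.concat h, fun x hx => ?_⟩
  rw [SimpleGraph.Walk.support_concat] at hx
  simp only [List.mem_append, List.mem_singleton] at hx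
  rcases hx with hx | rfl
  · exact hp _ hx
  · exact hw

/-- A walk starting in a set that is closed under taking neighbours outside `T`, and avoiding `T`,
stays in that set. -/
lemma walk_support_subset {R T : Set V} (hR : ∀ u ∈ R, ∀ w, G.Adj u w → w ∉ T → w ∈ R)
    {u v : V} (p : G.Walk u v) (hu : u ∈ R) (hp : ∀ w ∈ p.support, w ∉ T) :
    ∀ w ∈ p.support, w ∈ R := by
  induction p with
  | nil => simpa using hu
  | cons h p ih =>
    intro w hw
    rw [SimpleGraph.Walk.support_cons, List.mem_cons] at hw
    rcases hw with rfl | hw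
    · exact hu
    · refine ih (hR _ hu _ h (hp _ ?_)) (fun x hx => hp _ ?_) w hw
      · simp
      · simp [hx]

lemma walk_support_subset_reachAvoid {u v : V} (p : G.Walk u v) (hu : u ∈ A)
    (hp : ∀ w ∈ p.support, w ∉ S) : ∀ w ∈ p.support, w ∈ reachAvoid G A S :=
  walk_support_subset (fun _ h _ hadj hw => mem_reachAvoid_of_adj h hadj hw) p
    (mem_reachAvoid_of_mem hu (hp _ p.start_mem_support)) hp

/-- Induction principle for reachability: an upper bound on what is reachable only needs a set
closed under steps that avoid `S`. -/
lemma reachAvoid_subset {R : Set V} (hA : ∀ a ∈ A, a ∉ S → a ∈ R)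
    (hR : ∀ u ∈ R, ∀ w, G.Adj u w → w ∉ S → w ∈ R) : reachAvoid G A S ⊆ R := by
  rintro v ⟨a, ha, p, hp⟩
  exact walk_support_subset hR p (hA a ha (hp _ p.start_mem_support)) hp _ p.end_mem_support

lemma Separates.symm (h : Separates G A B S) : Separates G B A S := by
  rintro a ha ⟨b, hb, p, hp⟩
  exact h b hb ⟨a, ha, p.reverse, by simpa using hp⟩

/-- A walk from `A` to `B` meets every separating set. -/
lemma Separates.exists_mem (h : Separates G A B S) {a b : V} (ha : a ∈ A) (hb : b ∈ B)
    (p : G.Walk a b) : ∃ v ∈ p.support, v ∈ S := by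
  by_contra! hp
  exact h b hb ⟨a, ha, p, hp⟩

end Reach

/-- If `S` separates `A` from `B` in `G - xy`, and `y` is not reachable from `A` there, then
whatever separates `A` from `S ∪ {x}` in `G - xy` also separates `A` from `B` in `G`. -/
lemma separates_of_deleteEdge {G G' : SimpleGraph V} {A B S T : Set V} {x y : V}
    (hG : ∀ u v, G.Adj u v → s(u, v) ≠ s(x, y) → G'.Adj u v) (hS : Separates G' A B S)
    (hy : y ∉ reachAvoid G' A S) (hT : Separates G' A (insert x S) T) : Separates G A B T := by
  -- `T` separates `A` from `S`, so a walk of `G'` from `A` that avoids `T` also avoids `S`.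
  have hkey : reachAvoid G' A T ⊆ reachAvoid G' A S := by
    rintro v ⟨a, ha, p, hp⟩
    refine ⟨a, ha, p, fun w hw hwS => hT w (Set.mem_insert_of_mem _ hwS) ?_⟩
    exact walk_support_subset_reachAvoid p ha hp w hw
  -- The additional edge `xy` of `G` cannot be used: `x` is not reachable past `T`, and `y` is not
  -- even reachable past `S`.
  have hsub : reachAvoid G A T ⊆ reachAvoid G' A T := by
    refine reachAvoid_subset (fun a ha h => mem_reachAvoid_of_mem ha h) fun u hu w hadj hw => ?_
    refine mem_reachAvoid_of_adj hu (hG _ _ hadj fun he => ?_) hw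
    rw [Sym2.eq_iff] at he
    rcases he with ⟨rfl, _⟩ | ⟨rfl, _⟩
    · exact hT _ (Set.mem_insert _ _) hu
    · exact hy (hkey hu)
  exact fun b hb h => hS b hb (hkey (hsub h))

lemma eq_of_mem_takeUntil_of_mem_dropUntil {G : SimpleGraph V} [DecidableEq V] {s t v x : V} {p : G.Walk s t}
    (hp : p.IsPath) (hv : v ∈ p.support) (h1 : x ∈ (p.takeUntil v hv).support)
    (h2 : x ∈ (p.dropUntil v hv).support) : x = v := by
  by_contra hne
  have hnd := hp.support_nodup
  rw [← p.take_spec hv, SimpleGraph.Walk.support_append] at hnd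
  rw [SimpleGraph.Walk.mem_support_iff] at h2
  exact (List.nodup_append.1 hnd).2.2 _ h1 _ (h2.resolve_left hne) rfl

lemma DPath.mem_verts {G : SimpleGraph V} {P : DPath G} {v : V} :
    v ∈ P.verts ↔ v ∈ P.walk.support := by
  simp [DPath.verts, DPath.graph]

lemma DPath.fst_mem {G : SimpleGraph V} (P : DPath G) : P.fst ∈ P.verts := by
  simp [DPath.mem_verts]

lemma DPath.lst_mem {G : SimpleGraph V} (P : DPath G) : P.lst ∈ P.verts := by
  simp [DPath.mem_verts]

lemma PairwiseDisjointPaths.eq_of_mem {G : SimpleGraph V} {ι : Type*} {R : ι → DPath G}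
    (h : PairwiseDisjointPaths R) {i j : ι} {v : V} (hi : v ∈ (R i).verts)
    (hj : v ∈ (R j).verts) : i = j := by
  by_contra hij
  exact Set.disjoint_left.1 (h i j hij) hi hj

/-- Disjoint paths with first vertices in a set `X` of the same cardinality meet `X` in their first
vertices only, and use all of `X`. -/
lemma PairwiseDisjointPaths.fst_of_card {G : SimpleGraph V} {ι : Type*} [Finite ι] {R : ι → DPath G}
    (h : PairwiseDisjointPaths R) {X : Set V} (hX : X.Finite) (hR : ∀ i, (R i).fst ∈ X)
    (hc : X.ncard ≤ Nat.card ι) :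
    (∀ v ∈ X, ∃ i, (R i).fst = v) ∧ ∀ i, ∀ v ∈ (R i).verts, v ∈ X → v = (R i).fst := by
  have hinj : Function.Injective fun i => (R i).fst := fun i j hij =>
    h.eq_of_mem (R i).fst_mem (by simpa [← show (R i).fst = (R j).fst from hij] using (R j).fst_mem)
  have himg : Set.range (fun i => (R i).fst) = X := by
    refine Set.eq_of_subset_of_ncard_le (by rintro _ ⟨i, rfl⟩; exact hR i) ?_ hX
    rwa [← Set.image_univ, Set.ncard_image_of_injective _ hinj, Set.ncard_univ]
  have h1 : ∀ v ∈ X, ∃ i, (R i).fst = v := fun v hv => by rw [← himg] at hv; exact hv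
  refine ⟨h1, fun i v hv hvX => ?_⟩
  obtain ⟨j, rfl⟩ := h1 v hvX
  rw [h.eq_of_mem hv (R j).fst_mem]

/-- The reversed path. -/
def DPath.rev {G : SimpleGraph V} (P : DPath G) : DPath G :=
  ⟨P.lst, P.fst, P.walk.reverse, P.isPath.reverse⟩

lemma DPath.rev_verts {G : SimpleGraph V} (P : DPath G) : P.rev.verts = P.verts := by
  ext v; simp [DPath.mem_verts, DPath.rev]

lemma PairwiseDisjointPaths.rev {G : SimpleGraph V} {ι : Type*} {R : ι → DPath G}
    (h : PairwiseDisjointPaths R) : PairwiseDisjointPaths fun i => (R i).rev := fun i j hij => by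
  simpa [DPath.rev_verts] using h i j hij

lemma PairwiseDisjointPaths.lst_of_card {G : SimpleGraph V} {ι : Type*} [Finite ι] {R : ι → DPath G}
    (h : PairwiseDisjointPaths R) {X : Set V} (hX : X.Finite) (hR : ∀ i, (R i).lst ∈ X)
    (hc : X.ncard ≤ Nat.card ι) :
    (∀ v ∈ X, ∃ i, (R i).lst = v) ∧ ∀ i, ∀ v ∈ (R i).verts, v ∈ X → v = (R i).lst := by
  have := h.rev.fst_of_card hX hR hc
  exact ⟨this.1, fun i v hv => this.2 i v (by rwa [DPath.rev_verts])⟩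

/-- The image of a path in a larger graph. -/
def DPath.mapLe {G G' : SimpleGraph V} (h : G ≤ G') (P : DPath G) : DPath G' :=
  ⟨P.fst, P.lst, P.walk.mapLe h, P.isPath.mapLe h⟩

lemma DPath.mapLe_verts {G G' : SimpleGraph V} (h : G ≤ G') (P : DPath G) :
    (P.mapLe h).verts = P.verts := by
  ext v; simp [DPath.mem_verts, DPath.mapLe]

/-- A walk contains a path with the same ends. -/
lemma exists_dPath_of_walk {G : SimpleGraph V} {a b : V} (p : G.Walk a b) :
    ∃ R : DPath G, R.fst = a ∧ R.lst = b ∧ ∀ v ∈ R.verts, v ∈ p.support := by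
  classical
  exact ⟨⟨a, b, p.bypass, p.bypass_isPath⟩, rfl, rfl, fun v hv =>
    p.support_bypass_subset_support (DPath.mem_verts.1 hv)⟩

/-- Linkages from `A` to `S ∪ {x}` and from `S ∪ {y}` to `B` are joined through the edge `xy`. -/
lemma exists_linkage_of_join {G G' : SimpleGraph V} [Finite V] (hle : G' ≤ G) {A B S : Set V}
    {x y : V} {k : ℕ} (hxy : G.Adj x y) (hS : Separates G' A B S) (hk : S.ncard < k)
    (hy : y ∉ S)
    {R R' : Fin k → DPath G'} (hR : PairwiseDisjointPaths R) (hR' : PairwiseDisjointPaths R')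
    (hA : ∀ i, (R i).fst ∈ A) (hX : ∀ i, (R i).lst ∈ insert x S)
    (hY : ∀ i, (R' i).fst ∈ insert y S) (hB : ∀ i, (R' i).lst ∈ B) :
    ∃ R : Fin k → DPath G, PairwiseDisjointPaths R ∧ ∀ i, (R i).fst ∈ A ∧ (R i).lst ∈ B := by
  classical
  have hcard : ∀ z, (insert z S).ncard ≤ Nat.card (Fin k) := fun z =>
    (Set.ncard_insert_le z S).trans (by rw [Nat.card_fin]; omega)
  obtain ⟨-, hX2⟩ := hR.lst_of_card (Set.toFinite _) hX (hcard x)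
  obtain ⟨hY1, hY2⟩ := hR'.fst_of_card (Set.toFinite _) hY (hcard y)
  -- Following `R i` up to `v` and then `R' j` gives a walk of `G'` from `A` to `B`, which must meet
  -- `S`. But `R i` meets `S` at most in its last vertex and `R' j` at most in its first, so `v`
  -- itself is this vertex.
  have hmeet : ∀ i j v, v ∈ (R i).verts → v ∈ (R' j).verts →
      v ∈ S ∧ v = (R i).lst ∧ v = (R' j).fst := by
    intro i j v hi hj
    have hi' := DPath.mem_verts.1 hi
    have hj' := DPath.mem_verts.1 hj
    obtain ⟨s, hs, hsS⟩ := hS.exists_mem (hA i) (hB j)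
      (((R i).walk.takeUntil v hi').append ((R' j).walk.dropUntil v hj'))
    rw [SimpleGraph.Walk.mem_support_append_iff] at hs
    have hvS : v ∈ S := by
      rcases hs with hs | hs
      · have hsi : s ∈ (R i).verts :=
          DPath.mem_verts.2 ((R i).walk.support_takeUntil_subset_support hi' hs)
        have hsl := hX2 i s hsi (Set.mem_insert_of_mem _ hsS)
        by_contra hvS
        refine SimpleGraph.Walk.endpoint_notMem_support_takeUntil (R i).isPath hi' ?_ (hsl ▸ hs)
        rintro rfl
        exact hvS (hsl ▸ hsS)
      · have hsj : s ∈ (R' j).verts :=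
          DPath.mem_verts.2 ((R' j).walk.support_dropUntil_subset_support hj' hs)
        have hsl := hY2 j s hsj (Set.mem_insert_of_mem _ hsS)
        by_contra hvS
        have hne : v ≠ (R' j).fst := by
          rintro rfl
          exact hvS (hsl ▸ hsS)
        exact hne (eq_of_mem_takeUntil_of_mem_dropUntil (R' j).isPath hj'
          (SimpleGraph.Walk.start_mem_support _) (hsl ▸ hs)).symm
    exact ⟨hvS, hX2 i v hi (Set.mem_insert_of_mem _ hvS), hY2 j v hj (Set.mem_insert_of_mem _ hvS)⟩
  -- Partner of `R i`: the path that starts in its last vertex if this is in `S`, and the one that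
  -- starts in `y` if it ends in `x`.
  have hφ : ∀ i, ∃ j, ((R i).lst = (R' j).fst ∧ (R i).lst ∈ S) ∨
      ((R i).lst = x ∧ (R' j).fst = y) := by
    intro i
    rcases hX i with h | h
    · obtain ⟨j, hj⟩ := hY1 y (Set.mem_insert _ _)
      exact ⟨j, .inr ⟨h, hj⟩⟩
    · obtain ⟨j, hj⟩ := hY1 _ (Set.mem_insert_of_mem y h)
      exact ⟨j, .inl ⟨hj.symm, h⟩⟩
  choose φ hφ using hφ
  have hφinj : Function.Injective φ := by
    intro i j hij
    have hlst : (R i).lst = (R j).lst := by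
      rcases hφ i with ⟨h1, h1'⟩ | ⟨h1, h1'⟩ <;> rcases hφ j with ⟨h2, h2'⟩ | ⟨h2, h2'⟩
      · rw [h1, h2, hij]
      · rw [h1, hij, h2'] at h1'; exact absurd h1' hy
      · rw [h2, ← hij, h1'] at h2'; exact absurd h2' hy
      · rw [h1, h2]
    exact hR.eq_of_mem (R i).lst_mem (hlst ▸ (R j).lst_mem)
  have hN : ∀ i, ∃ N : DPath G, N.fst = (R i).fst ∧ N.lst = (R' (φ i)).lst ∧
      ∀ v ∈ N.verts, v ∈ (R i).verts ∨ v ∈ (R' (φ i)).verts := by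
    intro i
    rcases hφ i with ⟨h, _⟩ | ⟨h1, h2⟩
    · obtain ⟨N, h1, h2, h3⟩ := exists_dPath_of_walk
        (((R i).walk.mapLe hle).append (((R' (φ i)).walk.copy h.symm rfl).mapLe hle))
      refine ⟨N, h1, h2, fun v hv => ?_⟩
      have := h3 v hv
      rw [SimpleGraph.Walk.mem_support_append_iff] at this
      simpa [DPath.mem_verts] using this
    · obtain ⟨N, h1, h2, h3⟩ := exists_dPath_of_walk
        (((R i).walk.mapLe hle).append
          (.cons (show G.Adj (R i).lst (R' (φ i)).fst by rw [h1, h2]; exact hxy)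
            ((R' (φ i)).walk.mapLe hle)))
      refine ⟨N, h1, h2, fun v hv => ?_⟩
      have := h3 v hv
      rw [SimpleGraph.Walk.mem_support_append_iff, SimpleGraph.Walk.support_cons,
        List.mem_cons] at this
      rcases this with h | rfl | h
      · exact .inl (DPath.mem_verts.2 (by simpa using h))
      · exact .inl (R i).lst_mem
      · exact .inr (DPath.mem_verts.2 (by simpa using h))
  choose N hN1 hN2 hN3 using hN
  have hcross : ∀ i j v, v ∈ (R i).verts → v ∈ (R' (φ j)).verts → i = j := by
    intro i j v hi hj
    obtain ⟨hvS, h1, h2⟩ := hmeet i _ v hi hj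
    have : (R j).lst = v := by
      rcases hφ j with ⟨h3, _⟩ | ⟨_, h3⟩
      · rw [h3, h2]
      · rw [h2, h3] at hvS; exact absurd hvS hy
    exact hR.eq_of_mem hi (this ▸ (R j).lst_mem)
  refine ⟨N, fun i j hij => Set.disjoint_left.2 fun v hi hj => hij ?_, fun i => ?_⟩
  · rcases hN3 i v hi with hi | hi <;> rcases hN3 j v hj with hj | hj
    · exact hR.eq_of_mem hi hj
    · exact hcross i j v hi hj
    · exact (hcross j i v hj hi).symm
    · exact hφinj (hR'.eq_of_mem hi hj)
  · rw [hN1, hN2]; exact ⟨hA i, hB _⟩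

/-- **Menger's theorem**: if every set separating `A` from `B` has at least `k` vertices, then there
are `k` disjoint paths from `A` to `B`. -/
theorem exists_linkage_of_separates [Finite V] (G : SimpleGraph V) (A B : Set V) (k : ℕ)
    (h : ∀ S, Separates G A B S → k ≤ S.ncard) :
    ∃ R : Fin k → DPath G, PairwiseDisjointPaths R ∧ ∀ i, (R i).fst ∈ A ∧ (R i).lst ∈ B := by
  classical
  induction G using WellFoundedLT.induction generalizing A B with
  | ind G ih =>
  by_cases hG : G = ⊥
  · subst hG
    -- Without edges `A ∩ B` is itself a separator, and its vertices serve as trivial paths.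
    have hsep : Separates (⊥ : SimpleGraph V) A B (A ∩ B) := by
      intro b hb hr
      have : reachAvoid (⊥ : SimpleGraph V) A (A ∩ B) ⊆ A \ B :=
        reachAvoid_subset (fun a ha hab => ⟨ha, fun hb => hab ⟨ha, hb⟩⟩)
          (fun u _ w hadj => by simp at hadj)
      exact (this hr).2 hb
    have hk := h _ hsep
    have : Nonempty (Fin k ↪ (A ∩ B : Set V)) := by
      have : Fintype (A ∩ B : Set V) := Fintype.ofFinite _
      refine Function.Embedding.nonempty_of_card_le ?_
      rwa [Fintype.card_fin, ← Nat.card_eq_fintype_card, Nat.card_coe_set_eq]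
    obtain ⟨f⟩ := this
    refine ⟨fun i => ⟨f i, f i, .nil, .nil⟩, fun i j hij => ?_, fun i => (f i).2⟩
    refine Set.disjoint_left.2 fun v hi hj => hij (f.injective (Subtype.ext ?_))
    simp only [DPath.mem_verts, SimpleGraph.Walk.support_nil, List.mem_singleton] at hi hj
    rw [← hi, ← hj]
  · obtain ⟨x, y, hxy⟩ := SimpleGraph.ne_bot_iff_exists_adj.1 hG
    have hlt : G.deleteEdges {s(x, y)} < G := by
      refine lt_of_le_of_ne (SimpleGraph.deleteEdges_le _) fun he => ?_
      have : (G.deleteEdges {s(x, y)}).Adj x y := by rw [he]; exact hxy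
      simp at this
    by_cases h' : ∀ S, Separates (G.deleteEdges {s(x, y)}) A B S → k ≤ S.ncard
    · obtain ⟨R, hR, hAB⟩ := ih _ hlt A B h'
      refine ⟨fun i => (R i).mapLe hlt.le, fun i j hij => ?_, hAB⟩
      simpa only [DPath.mapLe_verts] using hR i j hij
    · push Not at h'
      obtain ⟨S, hS, hSk⟩ := h'
      -- The small set `S` separates only after `xy` is deleted. Hence `xy` joins the part reachable
      -- from `A` to the part reachable from `B`, and the induction hypothesis is used on either
      -- side of `S ∪ {x}` and `S ∪ {y}`.
      have hnot : ¬ Separates G A B S := fun hs => absurd (h S hs) (not_le.2 hSk)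
      have hside : ∀ {A B : Set V}, Separates (G.deleteEdges {s(x, y)}) A B S →
          ¬ Separates G A B S →
          (x ∈ reachAvoid (G.deleteEdges {s(x, y)}) A S ∧
            y ∉ reachAvoid (G.deleteEdges {s(x, y)}) A S) ∨
          (y ∈ reachAvoid (G.deleteEdges {s(x, y)}) A S ∧
            x ∉ reachAvoid (G.deleteEdges {s(x, y)}) A S) := by
        intro A B hS hnot
        by_contra hcon
        refine hnot fun b hb hr => hS b hb ?_
        refine reachAvoid_subset (fun a ha h => mem_reachAvoid_of_mem ha h)
          (fun u hu w hadj hw => ?_) hr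
        by_cases he : s(u, w) = s(x, y)
        · rw [Sym2.eq_iff] at he
          rcases he with ⟨rfl, rfl⟩ | ⟨rfl, rfl⟩ <;> tauto
        · exact mem_reachAvoid_of_adj hu (by simp [SimpleGraph.deleteEdges_adj, hadj, he]) hw
      have hdisj : ∀ z, z ∈ reachAvoid (G.deleteEdges {s(x, y)}) A S →
          z ∉ reachAvoid (G.deleteEdges {s(x, y)}) B S := by
        rintro z ⟨a, ha, p, hp⟩ ⟨b, hb, p', hp'⟩
        refine hS b hb ⟨a, ha, p.append p'.reverse, fun w hw => ?_⟩
        rw [SimpleGraph.Walk.mem_support_append_iff] at hw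
        rcases hw with hw | hw
        · exact hp w hw
        · exact hp' w (by simpa using hw)
      have main : ∀ x' y', s(x', y') = s(x, y) →
          x' ∈ reachAvoid (G.deleteEdges {s(x, y)}) A S →
          y' ∉ reachAvoid (G.deleteEdges {s(x, y)}) A S →
          y' ∈ reachAvoid (G.deleteEdges {s(x, y)}) B S →
          x' ∉ reachAvoid (G.deleteEdges {s(x, y)}) B S →
          ∃ R : Fin k → DPath G, PairwiseDisjointPaths R ∧
            ∀ i, (R i).fst ∈ A ∧ (R i).lst ∈ B := by
        intro x' y' he hxA hyA hyB hxB
        have hadj : G.Adj x' y' := by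
          rw [← SimpleGraph.mem_edgeSet, he]; exact hxy
        have hG' : ∀ u v, G.Adj u v → s(u, v) ≠ s(x', y') →
            (G.deleteEdges {s(x, y)}).Adj u v := fun u v h hne => by
          rw [SimpleGraph.deleteEdges_adj, ← he]; exact ⟨h, hne⟩
        obtain ⟨R, hR, hRAB⟩ := ih _ hlt A (insert x' S) fun T hT =>
          h T (separates_of_deleteEdge hG' hS hyA hT)
        obtain ⟨R', hR', hRAB'⟩ := ih _ hlt (insert y' S) B fun T hT =>
          h T (separates_of_deleteEdge (x := y') (y := x')
            (fun u v h hne => hG' u v h fun he => hne (he.trans Sym2.eq_swap)) hS.symm hxB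
            hT.symm).symm
        exact exists_linkage_of_join hlt.le hadj hS hSk
          (notMem_of_mem_reachAvoid hyB) hR hR' (fun i => (hRAB i).1) (fun i => (hRAB i).2)
          (fun i => (hRAB' i).1) (fun i => (hRAB' i).2)
      rcases hside hS hnot with ⟨h1, h2⟩ | ⟨h1, h2⟩ <;>
        rcases hside hS.symm (fun hs => hnot hs.symm) with ⟨h3, h4⟩ | ⟨h3, h4⟩
      · exact absurd h3 (hdisj _ h1)
      · exact main x y rfl h1 h2 h3 h4
      · exact main y x Sym2.eq_swap h1 h2 h3 h4
      · exact absurd h3 (hdisj _ h1)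

/-! ### Blocks -/

section Block

variable {G : SimpleGraph V}

lemma reachable_of_connected {K : G.Subgraph} (hK : K.Connected) {u v : V} (hu : u ∈ K.verts)
    (hv : v ∈ K.verts) : K.spanningCoe.Reachable u v := by
  obtain ⟨p, hp⟩ := (K.connected_iff_forall_exists_walk_subgraph.1 hK).2 hu hv
  refine ⟨p.transfer _ fun e he => ?_⟩
  induction e with
  | h a b =>
    rw [SimpleGraph.mem_edgeSet, SimpleGraph.Subgraph.spanningCoe_adj]
    exact hp.2 (SimpleGraph.Walk.adj_toSubgraph_iff_mem_edges.2 he)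

lemma mapLe_toSubgraph_le {K : G.Subgraph} {a b : V} (p : K.spanningCoe.Walk a b)
    (ha : a ∈ K.verts) : (p.mapLe K.spanningCoe_le).toSubgraph ≤ K := by
  induction p with
  | nil => simpa [SimpleGraph.singletonSubgraph_le_iff] using ha
  | cons hadj p ih =>
    rw [SimpleGraph.Subgraph.spanningCoe_adj] at hadj
    exact sup_le (SimpleGraph.subgraphOfAdj_le_of_adj _ hadj) (ih hadj.snd_mem)

lemma connected_of_reachable {K : G.Subgraph} {u : V} (hu : u ∈ K.verts)
    (h : ∀ v ∈ K.verts, K.spanningCoe.Reachable u v) : K.Connected := by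
  refine K.connected_iff_forall_exists_walk_subgraph.2 ⟨⟨u, hu⟩, fun {a b} ha hb => ?_⟩
  obtain ⟨p⟩ := (h a ha).symm.trans (h b hb)
  exact ⟨p.mapLe K.spanningCoe_le, mapLe_toSubgraph_le p ha⟩

lemma deleteVerts_mono {K K' : G.Subgraph} (h : K ≤ K') (s : Set V) :
    K.deleteVerts s ≤ K'.deleteVerts s := by
  refine ⟨Set.sdiff_subset_sdiff_left h.1, fun u v huv => ?_⟩
  simp only [SimpleGraph.Subgraph.deleteVerts_adj] at huv ⊢
  exact ⟨h.1 huv.1, huv.2.1, h.1 huv.2.2.1, huv.2.2.2.1, h.2 huv.2.2.2.2⟩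

lemma spanningCoe_mono {K K' : G.Subgraph} (h : K ≤ K') : K.spanningCoe ≤ K'.spanningCoe :=
  fun _ _ huv => h.2 huv

variable {H D : G.Subgraph}

/-- A subgraph without cut-vertex remains connected when a vertex is deleted. -/
lemma IsBlock.reachable_delete (hD : IsBlock H D) {x u v : V} (hu : u ∈ D.verts)
    (hv : v ∈ D.verts) (hux : u ≠ x) (hvx : v ≠ x) :
    (D.deleteVerts {x}).spanningCoe.Reachable u v := by
  by_cases hx : x ∈ D.verts
  · by_contra h
    exact hD.1.2.2 x ⟨hx, u, hu, v, hv, hux, hvx, reachable_of_connected hD.1.2.1 hu hv, h⟩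
  · refine (reachable_of_connected hD.1.2.1 hu hv).mono fun a b hab => ?_
    simp only [SimpleGraph.Subgraph.spanningCoe_adj, SimpleGraph.Subgraph.deleteVerts_adj,
      Set.mem_singleton_iff] at hab ⊢
    refine ⟨hab.fst_mem, ?_, hab.snd_mem, ?_, hab⟩ <;> rintro rfl
    · exact hx hab.fst_mem
    · exact hx hab.snd_mem

/-- Enlarging a block by a set `Y` of vertices, each of which stays joined to the block when another
vertex is deleted, does not change the block. -/
lemma IsBlock.induce_le (hD : IsBlock H D) {Y : Set V} (hY : Y ⊆ H.verts) {K : G.Subgraph}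
    (hK : K = H.induce (D.verts ∪ Y))
    (h : ∀ y ∈ Y, ∃ z ∈ D.verts, K.spanningCoe.Reachable y z)
    (hx : ∀ x, ∀ y ∈ Y, y ≠ x → y ∉ D.verts →
      ∃ z ∈ D.verts, z ≠ x ∧ (K.deleteVerts {x}).spanningCoe.Reachable y z) : K ≤ D := by
  have hDK : D ≤ K := by
    subst hK
    refine ⟨Set.subset_union_left, fun u v huv => ?_⟩
    exact ⟨.inl huv.fst_mem, .inl huv.snd_mem, hD.1.1.2 huv⟩
  have hKv : K.verts = D.verts ∪ Y := by subst hK; rfl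
  obtain ⟨d, hd⟩ := hD.1.2.1.nonempty
  refine hD.2 ⟨?_, ?_, ?_⟩ hDK
  · subst hK
    exact ⟨Set.union_subset hD.1.1.1 hY, fun u v huv => huv.2.2⟩
  · refine connected_of_reachable (hDK.1 hd) fun v hv => ?_
    have hr : ∀ z ∈ D.verts, K.spanningCoe.Reachable d z := fun z hz =>
      (reachable_of_connected hD.1.2.1 hd hz).mono (spanningCoe_mono hDK)
    rw [hKv] at hv
    rcases hv with hv | hv
    · exact hr v hv
    · obtain ⟨z, hz, hvz⟩ := h v hv
      exact (hr z hz).trans hvz.symm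
  · rintro x ⟨-, u, hu, v, hv, hux, hvx, -, hn⟩
    have key : ∀ w ∈ K.verts, w ≠ x →
        ∃ z ∈ D.verts, z ≠ x ∧ (K.deleteVerts {x}).spanningCoe.Reachable w z := by
      intro w hw hwx
      by_cases hwD : w ∈ D.verts
      · exact ⟨w, hwD, hwx, .rfl⟩
      · rw [hKv] at hw
        exact hx x w (hw.resolve_left hwD) hwx hwD
    obtain ⟨z, hz, hzx, huz⟩ := key u hu hux
    obtain ⟨z', hz', hzx', hvz⟩ := key v hv hvx
    exact hn ((huz.trans ((hD.reachable_delete hz hz' hzx hzx').mono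
      (spanningCoe_mono (deleteVerts_mono hDK _)))).trans hvz.symm)

/-- Blocks are induced subgraphs. -/
lemma IsBlock.adj_of_mem (hD : IsBlock H D) {u v : V} (hu : u ∈ D.verts) (hv : v ∈ D.verts)
    (h : H.Adj u v) : D.Adj u v :=
  (hD.induce_le (Y := ∅) (by simp) rfl (by simp) (by simp)).2 ⟨.inl hu, .inl hv, h⟩

/-- A path whose distinct ends are in a block is contained in the block. -/
lemma IsBlock.support_subset (hD : IsBlock H D) {u v : V} (hu : u ∈ D.verts) (hv : v ∈ D.verts)
    (p : H.spanningCoe.Walk u v) (hp : p.IsPath) :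
    ∀ w ∈ p.support, w ∈ D.verts := by
  classical
  have hY : {w | w ∈ p.support} ⊆ H.verts := by
    intro w hw
    by_cases hwu : w = u
    · exact hwu ▸ hD.1.1.1 hu
    have hs : w ∈ p.support := hw
    have hn : ¬ (p.takeUntil w hs).Nil := fun hnil => hwu hnil.eq.symm
    have := SimpleGraph.Walk.adj_penultimate hn
    rw [SimpleGraph.Subgraph.spanningCoe_adj] at this
    exact this.snd_mem
  set K := H.induce (D.verts ∪ {w | w ∈ p.support}) with hK
  have walkK : ∀ {a b : V} (q : H.spanningCoe.Walk a b) (x : V),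
      (∀ w ∈ q.support, w ∈ p.support ∧ w ≠ x) →
      (K.deleteVerts {x}).spanningCoe.Reachable a b := by
    intro a b q x hq
    induction q with
    | nil => exact .rfl
    | cons hadj q ih =>
      refine .trans (SimpleGraph.Adj.reachable ?_) (ih fun w hw => hq w (by simp [hw]))
      have h1 := hq _ (SimpleGraph.Walk.start_mem_support (q.cons hadj))
      have h2 := hq _ (List.mem_cons_of_mem _ q.start_mem_support)
      rw [SimpleGraph.Subgraph.spanningCoe_adj, SimpleGraph.Subgraph.deleteVerts_adj]
      exact ⟨.inr h1.1, h1.2, .inr h2.1, h2.2, .inr h1.1, .inr h2.1, hadj⟩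
  -- The vertex `x` cannot lie on both sides of `y` on the path, so one of the two segments from `y`
  -- to the ends survives in `K - x`.
  have main : ∀ x, ∀ y ∈ {w | w ∈ p.support}, y ≠ x →
      ∃ z ∈ D.verts, z ≠ x ∧ (K.deleteVerts {x}).spanningCoe.Reachable y z := by
    intro x y hy hyx
    have hy' : y ∈ p.support := hy
    by_cases hx : x ∈ (p.takeUntil y hy').support
    · have hx2 : x ∉ (p.dropUntil y hy').support := by
        intro hx2
        exact hyx (eq_of_mem_takeUntil_of_mem_dropUntil hp hy' hx hx2).symm
      refine ⟨v, hv, fun h => hx2 (h ▸ SimpleGraph.Walk.end_mem_support _),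
        walkK (p.dropUntil y hy') x fun w hw => ⟨p.support_dropUntil_subset_support hy' hw, ?_⟩⟩
      rintro rfl; exact hx2 hw
    · refine ⟨u, hu, fun h => hx (h ▸ SimpleGraph.Walk.start_mem_support _),
        (walkK (p.takeUntil y hy') x fun w hw =>
          ⟨p.support_takeUntil_subset_support hy' hw, ?_⟩).symm⟩
      rintro rfl; exact hx hw
  refine fun w hw => (hD.induce_le hY hK (fun y hy => ?_) fun x y hy hyx _ => main x y hy hyx).1
    (.inr hw)
  by_cases hyu : y = u
  · exact ⟨u, hu, hyu ▸ .rfl⟩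
  · obtain ⟨z, hz, -, h⟩ := main u y hy hyu
    refine ⟨z, hz, h.mono (spanningCoe_mono ?_)⟩
    exact SimpleGraph.Subgraph.deleteVerts_le

/-- A vertex outside a block has at most one neighbour in the block. -/
lemma IsBlock.mem_of_two_adj (hD : IsBlock H D) {u v w : V} (hu : u ∈ D.verts) (hv : v ∈ D.verts)
    (huv : u ≠ v) (hwu : H.Adj w u) (hwv : H.Adj w v) : w ∈ D.verts := by
  have h1 : H.spanningCoe.Adj u w := hwu.symm
  have h2 : H.spanningCoe.Adj w v := hwv
  refine hD.support_subset hu hv (.cons h1 (.cons h2 .nil)) ?_ w (by simp)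
  simp [SimpleGraph.Walk.cons_isPath_iff, h1.ne, h2.ne, huv]

/-- All neighbours of a vertex of a block are in the block, unless the vertex is a cut-vertex. -/
lemma IsBlock.mem_of_adj (hD : IsBlock H D) {u v : V} (hu : u ∈ D.verts) (hcut : ¬ IsCutVertex H u)
    (h : H.Adj u v) : v ∈ D.verts := by
  classical
  by_cases hex : ∃ w ∈ D.verts, w ≠ u
  -- As `u` is not a cut-vertex, `v` reaches `w` in `H - u`. Together with `uv` this gives a path
  -- through `v` with both ends in the block.
  · obtain ⟨w, hw, hwu⟩ := hex
    have hr : (H.deleteVerts {u}).spanningCoe.Reachable v w := by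
      by_contra hn
      refine hcut ⟨hD.1.1.1 hu, v, h.snd_mem, w, hD.1.1.1 hw, h.adj_sub.ne', hwu, ?_, hn⟩
      exact (SimpleGraph.Adj.reachable (G := H.spanningCoe) h.symm).trans
        ((reachable_of_connected hD.1.2.1 hu hw).mono (spanningCoe_mono hD.1.1))
    obtain ⟨p, hp⟩ := hr.exists_isPath
    have hle : (H.deleteVerts {u}).spanningCoe ≤ H.spanningCoe :=
      spanningCoe_mono SimpleGraph.Subgraph.deleteVerts_le
    have h' : H.spanningCoe.Adj u v := h
    refine hD.support_subset hu hw (.cons h' (p.mapLe hle)) ?_ v (by simp)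
    refine (SimpleGraph.Walk.cons_isPath_iff _ _).2 ⟨hp.mapLe hle, ?_⟩
    intro hmem
    have hmem' : u ∈ p.support := by simpa using hmem
    have : ∀ x ∈ p.support, x ∉ ({u} : Set V) := by
      have hall : ∀ {a b : V} (q : (H.deleteVerts {u}).spanningCoe.Walk a b), a ≠ u →
          ∀ x ∈ q.support, x ≠ u := by
        intro a b q ha
        induction q with
        | nil => simpa using ha
        | cons hadj q ih =>
          intro x hx
          rw [SimpleGraph.Walk.support_cons, List.mem_cons] at hx
          rcases hx with rfl | hx
          · exact ha
          · refine ih ?_ x hx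
            rw [SimpleGraph.Subgraph.spanningCoe_adj, SimpleGraph.Subgraph.deleteVerts_adj] at hadj
            exact hadj.2.2.2.1
      exact hall p h.adj_sub.ne'
    exact this u hmem' rfl
  -- Here `D` is the single vertex `u`, but the edge `uv` is a larger connected subgraph without
  -- cut-vertex.
  · push Not at hex
    have hDu : D.verts = {u} := by
      ext w; exact ⟨hex w, by rintro rfl; exact hu⟩
    have hle : D ≤ H.induce {u, v} := by
      refine ⟨by simp [hDu], fun a b hab => ?_⟩
      have ha : a = u := hex a hab.fst_mem
      have hb : b = u := hex b hab.snd_mem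
      exact absurd (ha.trans hb.symm) hab.adj_sub.ne
    have hleH : H.induce {u, v} ≤ H := by
      refine ⟨?_, fun a b hab => hab.2.2⟩
      rintro w (rfl | rfl)
      · exact h.fst_mem
      · exact h.snd_mem
    refine (hD.2 (y := H.induce {u, v}) ⟨hleH, ?_, ?_⟩ hle).1 (.inr rfl)
    · refine connected_of_reachable (u := u) (.inl rfl) ?_
      rintro w (rfl | rfl)
      · exact .rfl
      · exact SimpleGraph.Adj.reachable (G := (H.induce {u, w}).spanningCoe)
          ⟨.inl rfl, .inr rfl, h⟩
    · rintro x ⟨hx, a, ha, b, hb, hax, hbx, -, hn⟩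
      have hab : a = b := by
        rcases hx with rfl | rfl <;> rcases ha with rfl | rfl <;> rcases hb with rfl | rfl <;>
          simp_all
      exact hn (hab ▸ .rfl)

/-- If the walk visits `x`, it is stopped at the vertex `a` just before the first visit. -/
lemma reachable_delete_or (x : V) {u v : V} (p : H.spanningCoe.Walk u v) (hu : u ≠ x) :
    (v ≠ x ∧ (H.deleteVerts {x}).spanningCoe.Reachable u v) ∨
      ∃ a, H.Adj a x ∧ (H.deleteVerts {x}).spanningCoe.Reachable u a := by
  induction p with
  | nil => exact .inl ⟨hu, .rfl⟩
  | @cons u w v h p ih =>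
    have h' : H.Adj u w := h
    by_cases hw : w = x
    · exact .inr ⟨u, hw ▸ h', .rfl⟩
    · have hadj : (H.deleteVerts {x}).spanningCoe.Adj u w := by
        simp [h', hu, hw, h'.fst_mem, h'.snd_mem]
      rcases ih hw with ⟨h1, h2⟩ | ⟨a, h1, h2⟩
      · exact .inl ⟨h1, hadj.reachable.trans h2⟩
      · exact .inr ⟨a, h1, hadj.reachable.trans h2⟩

/-- A cut-vertex in a block has a neighbour outside the block. -/
lemma IsBlock.exists_adj_of_isCutVertex (hD : IsBlock H D) {x : V} (hcut : IsCutVertex H x) :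
    ∃ a, H.Adj x a ∧ a ∉ D.verts := by
  by_contra! hcon
  obtain ⟨-, u, -, v, -, hux, hvx, ⟨p⟩, hn⟩ := hcut
  -- If all neighbours of `x` were in `D`, the walk would enter and leave `x` through `D`, and could
  -- be rerouted through the connected graph `D - x`.
  rcases reachable_delete_or x p hux with ⟨-, h⟩ | ⟨a, ha, hua⟩
  · exact hn h
  rcases reachable_delete_or x p.reverse hvx with ⟨-, h⟩ | ⟨b, hb, hvb⟩
  · exact hn h.symm
  exact hn ((hua.trans ((hD.reachable_delete (hcon a ha.symm) (hcon b hb.symm) ha.adj_sub.ne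
    hb.adj_sub.ne).mono (spanningCoe_mono (deleteVerts_mono hD.1.1 _)))).trans hvb.symm)

end Block

/-- A block `D` of `Γ[L]` has at least as many neighbours in `L` as cut-vertices of `Γ[L]`. -/
lemma ncard_cutIn_le {ι : Type*} [Finite ι] {Γ : SimpleGraph ι} {L : Set ι} {D : Γ.Subgraph}
    (hD : IsBlock (inducedOn Γ L) D) : (cutIn L D).ncard ≤ (nbhd D ∩ L).ncard := by
  have hf : ∀ α : ι, ∃ β, α ∈ cutIn L D → (inducedOn Γ L).Adj α β ∧ β ∉ D.verts := by
    intro α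
    by_cases hα : α ∈ cutIn L D
    · obtain ⟨β, hβ⟩ := hD.exists_adj_of_isCutVertex hα.2
      exact ⟨β, fun _ => hβ⟩
    · exact ⟨α, fun h => absurd h hα⟩
  choose f hf using hf
  refine Set.ncard_le_ncard_of_injOn f (fun α hα => ?_) ?_ (Set.toFinite _)
  · obtain ⟨h1, h2⟩ := hf α hα
    exact ⟨⟨h2, α, hα.1, h1.adj_sub⟩, h1.snd_mem⟩
  -- Two distinct cut-vertices cannot choose the same neighbour: a vertex with two neighbours in the
  -- block belongs to it.
  · intro α hα β hβ he
    by_contra hne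
    refine (hf α hα).2 (hD.mem_of_two_adj hα.1 hβ.1 hne (hf α hα).1.symm ?_)
    rw [he]; exact (hf β hβ).1.symm

/-! ### Paths and separations -/

section PathSep

variable {G : SimpleGraph V}

/-- A walk from `L` to `R` meets `L ∩ R` if every edge has both ends in `L` or in `R`. -/
lemma exists_mem_inter {L R : Set V} (h : ∀ u v, G.Adj u v → u ∈ L ∧ v ∈ L ∨ u ∈ R ∧ v ∈ R)
    {s t : V} (p : G.Walk s t) (hs : s ∈ L) (ht : t ∈ R) : ∃ v ∈ p.support, v ∈ L ∧ v ∈ R := by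
  induction p with
  | nil => exact ⟨_, by simp, hs, ht⟩
  | cons hadj p ih =>
    rcases h _ _ hadj with ⟨_, hw⟩ | ⟨hu, _⟩
    · obtain ⟨v, hv, hv'⟩ := ih hw ht
      exact ⟨v, by simp [hv], hv'⟩
    · exact ⟨_, by simp, hs, hu⟩

lemma DPath.verts_eq_of_fst_eq_lst (P : DPath G) (h : P.fst = P.lst) : P.verts = {P.fst} := by
  obtain ⟨a, b, p, hp⟩ := P
  dsimp only at h
  subst h
  obtain rfl := (SimpleGraph.Walk.isPath_iff_nil.1 hp).eq_nil
  ext v; simp [DPath.mem_verts]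

lemma DPath.isTrivialPath_iff (P : DPath G) : IsTrivialPath P.graph ↔ P.fst = P.lst := by
  constructor
  · intro h
    obtain ⟨a, ha⟩ := Set.ncard_eq_one.1 h
    have h1 : P.fst ∈ P.graph.verts := P.fst_mem
    have h2 : P.lst ∈ P.graph.verts := P.lst_mem
    rw [ha] at h1 h2
    exact h1.trans h2.symm
  · intro h
    have := P.verts_eq_of_fst_eq_lst h
    exact Set.ncard_eq_one.2 ⟨_, this⟩

/-- If a path from `L` to `R` meets `L ∩ R` in `b` only, then its part in `L` is its initial
segment ending in `b`. -/
lemma DPath.exists_left {L R : Set V} (hc : ∀ v, v ∈ L ∨ v ∈ R)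
    (h : ∀ u v, G.Adj u v → u ∈ L ∧ v ∈ L ∨ u ∈ R ∧ v ∈ R) (P : DPath G) (hs : P.fst ∈ L)
    (ht : P.lst ∈ R) {b : V} (hb : b ∈ P.verts) (hbL : b ∈ L) (hbR : b ∈ R)
    (hu : ∀ v ∈ P.verts, v ∈ L → v ∈ R → v = b) :
    ∃ N : DPath G, N.fst = P.fst ∧ N.lst = b ∧ N.verts = P.verts ∩ L ∧ N.graph ≤ P.graph := by
  classical
  have hb' := DPath.mem_verts.1 hb
  -- The path cannot leave `L` before `b` nor have a vertex of `L` after it, since either would need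
  -- a second passage through `L ∩ R`.
  refine ⟨⟨P.fst, b, P.walk.takeUntil b hb', P.isPath.takeUntil hb'⟩, rfl, rfl, ?_, ?_⟩
  · ext v
    rw [DPath.mem_verts]
    constructor
    · intro hv
      have hvP := P.walk.support_takeUntil_subset_support hb' hv
      refine ⟨DPath.mem_verts.2 hvP, ?_⟩
      by_contra hvL
      obtain ⟨w, hw, hwL, hwR⟩ := exists_mem_inter h
        ((P.walk.takeUntil b hb').takeUntil v hv) hs ((hc v).resolve_left hvL)
      have hwb : w = b := hu w (DPath.mem_verts.2 (P.walk.support_takeUntil_subset_support hb'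
        ((P.walk.takeUntil b hb').support_takeUntil_subset_support hv hw))) hwL hwR
      subst hwb
      exact SimpleGraph.Walk.endpoint_notMem_support_takeUntil (P.isPath.takeUntil hb') hv
        (by rintro rfl; exact hvL hbL) hw
    · rintro ⟨hvP, hvL⟩
      have hvP' := DPath.mem_verts.1 hvP
      rw [← P.walk.take_spec hb', SimpleGraph.Walk.mem_support_append_iff] at hvP'
      rcases hvP' with hv | hv
      · exact hv
      · obtain ⟨w, hw, hwL, hwR⟩ := exists_mem_inter h
          ((P.walk.dropUntil b hb').dropUntil v hv) hvL ht
        have hwb : w = b := hu w (DPath.mem_verts.2 (P.walk.support_dropUntil_subset_support hb'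
          ((P.walk.dropUntil b hb').support_dropUntil_subset_support hv hw))) hwL hwR
        subst hwb
        have := eq_of_mem_takeUntil_of_mem_dropUntil (P.isPath.dropUntil hb') hv
          (SimpleGraph.Walk.start_mem_support _) hw
        rw [← this]
        exact SimpleGraph.Walk.end_mem_support _
  · have := SimpleGraph.Walk.toSubgraph_append (P.walk.takeUntil b hb') (P.walk.dropUntil b hb')
    rw [P.walk.take_spec hb'] at this
    change (P.walk.takeUntil b hb').toSubgraph ≤ P.walk.toSubgraph
    rw [this]
    exact le_sup_left

lemma DPath.rev_graph (P : DPath G) : P.rev.graph = P.graph :=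
  SimpleGraph.Walk.toSubgraph_reverse _

lemma DPath.exists_right {L R : Set V} (hc : ∀ v, v ∈ L ∨ v ∈ R)
    (h : ∀ u v, G.Adj u v → u ∈ L ∧ v ∈ L ∨ u ∈ R ∧ v ∈ R) (P : DPath G) (hs : P.fst ∈ L)
    (ht : P.lst ∈ R) {b : V} (hb : b ∈ P.verts) (hbL : b ∈ L) (hbR : b ∈ R)
    (hu : ∀ v ∈ P.verts, v ∈ L → v ∈ R → v = b) :
    ∃ N : DPath G, N.fst = b ∧ N.lst = P.lst ∧ N.verts = P.verts ∩ R ∧ N.graph ≤ P.graph := by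
  obtain ⟨N, h1, h2, h3, h4⟩ := P.rev.exists_left (L := R) (R := L) (fun v => (hc v).symm)
    (fun u v huv => (h u v huv).symm) ht hs (by rwa [P.rev_verts]) hbR hbL
    (fun v hv hR hL => hu v (by rwa [P.rev_verts] at hv) hL hR)
  exact ⟨N.rev, h2, h1, by rw [N.rev_verts, h3, P.rev_verts],
    by rw [N.rev_graph]; rwa [P.rev_graph] at h4⟩

/-- If each of a family of disjoint paths meets the set `X`, which has no more vertices than there
are paths, then `X` is a transversal of the paths. -/
lemma PairwiseDisjointPaths.transversal {ι : Type*} [Finite ι] {R : ι → DPath G}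
    (h : PairwiseDisjointPaths R) {X : Set V} (hX : X.Finite) (hc : X.ncard ≤ Nat.card ι)
    (hm : ∀ i, ∃ v ∈ (R i).verts, v ∈ X) :
    (∀ v ∈ X, ∃ i, v ∈ (R i).verts) ∧
      (∀ i, ∀ u ∈ (R i).verts, u ∈ X → ∀ v ∈ (R i).verts, v ∈ X → u = v) ∧
      X.ncard = Nat.card ι := by
  choose b hb hbX using hm
  have hinj : Function.Injective b := fun i j hij => h.eq_of_mem (hb i) (hij ▸ hb j)
  have hsub : Set.range b ⊆ X := by rintro _ ⟨i, rfl⟩; exact hbX i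
  have hcard : (Set.range b).ncard = Nat.card ι := by
    rw [← Set.image_univ, Set.ncard_image_of_injective _ hinj, Set.ncard_univ]
  have himg : Set.range b = X := Set.eq_of_subset_of_ncard_le hsub (by rwa [hcard]) hX
  have hall : ∀ i, ∀ u ∈ (R i).verts, u ∈ X → u = b i := by
    intro i u hu huX
    rw [← himg] at huX
    obtain ⟨j, rfl⟩ := huX
    rw [h.eq_of_mem hu (hb j)]
  refine ⟨fun v hv => ?_, fun i u hu huX v hv hvX => (hall i u hu huX).trans (hall i v hv hvX).symm,
    by rw [← himg, hcard]⟩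
  rw [← himg] at hv
  obtain ⟨i, rfl⟩ := hv
  exact ⟨i, hb i⟩

end PathSep

/-! ### Linkages in slim decompositions -/

/-- The union of the bags up to `W i`. -/
def leftBags (W : ℕ → Set V) (i : ℕ) : Set V := {v | ∃ j ≤ i, v ∈ W j}

/-- The union of the bags after `W i`. -/
def rightBags (W : ℕ → Set V) (l i : ℕ) : Set V := {v | ∃ j, i < j ∧ j ≤ l ∧ v ∈ W j}

section Slim

variable {G : SimpleGraph V} {W : ℕ → Set V} {l q : ℕ}

lemma IsSlim.mem_left_or_right (h : IsSlim G W l q) (i : ℕ) (v : V) :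
    v ∈ leftBags W i ∨ v ∈ rightBags W l i := by
  obtain ⟨j, hj, hv⟩ := h.cover v
  rcases le_or_gt j i with hi | hi
  · exact .inl ⟨j, hi, hv⟩
  · exact .inr ⟨j, hi, hj, hv⟩

lemma IsSlim.adj_left_or_right (h : IsSlim G W l q) (i : ℕ) (u v : V) (huv : G.Adj u v) :
    u ∈ leftBags W i ∧ v ∈ leftBags W i ∨ u ∈ rightBags W l i ∧ v ∈ rightBags W l i := by
  obtain ⟨j, hj, hu, hv⟩ := h.cover_edge u v huv
  rcases le_or_gt j i with hi | hi
  · exact .inl ⟨⟨j, hi, hu⟩, ⟨j, hi, hv⟩⟩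
  · exact .inr ⟨⟨j, hi, hj, hu⟩, ⟨j, hi, hj, hv⟩⟩

lemma IsSlim.mem_of_le (h : IsSlim G W l q) {i j k : ℕ} (hij : i ≤ j) (hjk : j ≤ k) (hk : k ≤ l)
    {v : V} (hi : v ∈ W i) (hk' : v ∈ W k) : v ∈ W j :=
  h.interval i j k hij hjk hk ⟨hi, hk'⟩

lemma IsSlim.mem_adh (h : IsSlim G W l q) {i : ℕ} {v : V} (h1 : v ∈ leftBags W i)
    (h2 : v ∈ rightBags W l i) : v ∈ adh W i := by
  obtain ⟨j, hj, hv⟩ := h1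
  obtain ⟨k, hk, hkl, hv'⟩ := h2
  exact ⟨h.mem_of_le hj hk.le hkl hv hv', h.mem_of_le (by omega) hk hkl hv hv'⟩

lemma adh_subset_left {i j : ℕ} (hij : i ≤ j) : adh W i ⊆ leftBags W j := fun _ hv => ⟨i, hij, hv.1⟩

lemma adh_subset_right {i j : ℕ} (hij : i ≤ j) (hj : j < l) : adh W j ⊆ rightBags W l i :=
  fun _ hv => ⟨j + 1, by omega, hj, hv.2⟩

variable {Q : Fin q → DPath G}

lemma IsFoundational.fst_mem (hQ : IsFoundational W l Q) (α : Fin q) : (Q α).fst ∈ adh W 0 := by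
  have : (Q α).fst ∈ (Q α).verts ∩ adh W 0 := by rw [(hQ.2.2.1 α).1]; rfl
  exact this.2

lemma IsFoundational.lst_mem (hQ : IsFoundational W l Q) (α : Fin q) :
    (Q α).lst ∈ adh W (l - 1) := by
  have : (Q α).lst ∈ (Q α).verts ∩ adh W (l - 1) := by rw [(hQ.2.2.1 α).2]; rfl
  exact this.2

lemma IsFoundational.eq_of_mem (hQ : IsFoundational W l Q) {α β : Fin q} {v : V}
    (h1 : v ∈ (Q α).verts) (h2 : v ∈ (Q β).verts) : α = β :=
  hQ.2.2.2.eq_of_mem h1 h2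

lemma IsFoundational.exists_mem_adh (hQ : IsFoundational W l Q) (h : IsSlim G W l q) {i : ℕ}
    (hi : i < l) (α : Fin q) : ∃ v ∈ (Q α).verts, v ∈ adh W i := by
  obtain ⟨v, hv, h1, h2⟩ := exists_mem_inter (h.adj_left_or_right i) (Q α).walk
    (adh_subset_left (Nat.zero_le i) (hQ.fst_mem α))
    (adh_subset_right (by omega) (by omega) (hQ.lst_mem α))
  exact ⟨v, DPath.mem_verts.2 hv, h.mem_adh h1 h2⟩

variable [Finite V]

lemma IsFoundational.eq_of_mem_adh (hQ : IsFoundational W l Q) (h : IsSlim G W l q) {i : ℕ}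
    (hi : i < l) {α : Fin q} {u v : V} (hu : u ∈ (Q α).verts) (hu' : u ∈ adh W i)
    (hv : v ∈ (Q α).verts) (hv' : v ∈ adh W i) : u = v :=
  (hQ.2.2.2.transversal (Set.toFinite _) (by rw [h.adhesion i hi, Nat.card_fin])
    (hQ.exists_mem_adh h hi)).2.1 α u hu hu' v hv hv'

lemma IsFoundational.exists_of_mem_adh (hQ : IsFoundational W l Q) (h : IsSlim G W l q) {i : ℕ}
    (hi : i < l) {v : V} (hv : v ∈ adh W i) : ∃ α, v ∈ (Q α).verts :=
  (hQ.2.2.2.transversal (Set.toFinite _) (by rw [h.adhesion i hi, Nat.card_fin])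
    (hQ.exists_mem_adh h hi)).1 v hv

lemma IsFoundational.exists_left (hQ : IsFoundational W l Q) (h : IsSlim G W l q) {i : ℕ}
    (hi : i < l) (α : Fin q) : ∃ N : DPath G, N.fst = (Q α).fst ∧ N.lst ∈ adh W i ∧
      N.verts = (Q α).verts ∩ leftBags W i ∧ N.graph ≤ (Q α).graph := by
  obtain ⟨b, hb, hbi⟩ := hQ.exists_mem_adh h hi α
  obtain ⟨N, h1, h2, h3⟩ := (Q α).exists_left (h.mem_left_or_right i) (h.adj_left_or_right i)
    (adh_subset_left (Nat.zero_le i) (hQ.fst_mem α))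
    (adh_subset_right (by omega) (by omega) (hQ.lst_mem α)) hb
    (adh_subset_left le_rfl hbi) (adh_subset_right le_rfl hi hbi)
    (fun v hv hL hR => hQ.eq_of_mem_adh h hi hv (h.mem_adh hL hR) hb hbi)
  exact ⟨N, h1, h2 ▸ hbi, h3⟩

/-- The segment of a path of a foundational linkage in an inner bag. -/
lemma IsFoundational.exists_segment (hQ : IsFoundational W l Q) (h : IsSlim G W l q) {i : ℕ}
    (h1 : 1 ≤ i) (hi : i < l) (α : Fin q) : ∃ N : DPath G, N.fst ∈ adh W (i - 1) ∧
      N.lst ∈ adh W i ∧ N.verts = (Q α).verts ∩ W i ∧ N.graph ≤ (Q α).graph := by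
  obtain ⟨N, hN1, hN2, hN3, hN4⟩ := hQ.exists_left h hi α
  obtain ⟨b, hb, hbi⟩ := hQ.exists_mem_adh h (show i - 1 < l by omega) α
  obtain ⟨M, hM1, hM2, hM3, hM4⟩ := N.exists_right (h.mem_left_or_right (i - 1))
    (h.adj_left_or_right (i - 1))
    (by rw [hN1]; exact adh_subset_left (Nat.zero_le _) (hQ.fst_mem α))
    (adh_subset_right (by omega) hi hN2) (b := b)
    (by rw [hN3]; exact ⟨hb, adh_subset_left (by omega) hbi⟩)
    (adh_subset_left le_rfl hbi) (adh_subset_right le_rfl (by omega) hbi)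
    (fun v hv hL hR => by
      rw [hN3] at hv
      exact hQ.eq_of_mem_adh h (by omega) hv.1 (h.mem_adh hL hR) hb hbi)
  refine ⟨M, hM1 ▸ hbi, hM2 ▸ hN2, ?_, hM4.trans hN4⟩
  -- By the interval property, the bags up to `W i` and the bags after `W (i - 1)` have exactly `W
  -- i` in common.
  rw [hM3, hN3, Set.inter_assoc]
  congr 1
  ext v
  constructor
  · rintro ⟨⟨j, hj, hv⟩, ⟨k, hk, hkl, hv'⟩⟩
    exact h.mem_of_le hj (by omega) hkl hv hv'
  · intro hv
    exact ⟨⟨i, le_rfl, hv⟩, ⟨i, by omega, hi.le, hv⟩⟩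

/-- The part of the path in `W 0` starts and ends on the first adhesion set, which the path meets
only once; so this part is trivial. -/
lemma IsFoundational.eq_fst_of_mem_zero (hQ : IsFoundational W l Q) (h : IsSlim G W l q)
    (hl : 0 < l) {α : Fin q} {v : V} (hv : v ∈ (Q α).verts) (hv0 : v ∈ W 0) : v = (Q α).fst := by
  obtain ⟨N, h1, h2, h3, -⟩ := hQ.exists_left h hl α
  have hN : N.lst ∈ (Q α).verts := (h3 ▸ N.lst_mem).1
  have := N.verts_eq_of_fst_eq_lst
    (by rw [h1]; exact hQ.eq_of_mem_adh h hl (Q α).fst_mem (hQ.fst_mem α) hN h2)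
  rw [h3, h1] at this
  exact this.subset ⟨hv, 0, le_rfl, hv0⟩

lemma IsFoundational.eq_lst_of_mem_last (hQ : IsFoundational W l Q) (h : IsSlim G W l q)
    (hl : 0 < l) {α : Fin q} {v : V} (hv : v ∈ (Q α).verts) (hvl : v ∈ W l) : v = (Q α).lst := by
  obtain ⟨N, h1, h2, h3, -⟩ := (Q α).exists_right (h.mem_left_or_right (l - 1))
    (h.adj_left_or_right (l - 1)) (adh_subset_left (Nat.zero_le _) (hQ.fst_mem α))
    (adh_subset_right le_rfl (by omega) (hQ.lst_mem α)) (Q α).lst_mem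
    (adh_subset_left le_rfl (hQ.lst_mem α)) (adh_subset_right le_rfl (by omega) (hQ.lst_mem α))
    (fun v hv hL hR => hQ.eq_of_mem_adh h (by omega) hv (h.mem_adh hL hR) (Q α).lst_mem
      (hQ.lst_mem α))
  have := N.verts_eq_of_fst_eq_lst (by rw [h1, h2])
  rw [h3, h1] at this
  exact this.subset ⟨hv, l, by omega, le_rfl, hvl⟩

end Slim

/-! ### Trivial paths and induced permutations in regular and stable decompositions. -/

section Regular

variable {G : SimpleGraph V} {W : ℕ → Set V} {l q p : ℕ} {P Q : Fin q → DPath G}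

lemma mem_theta_iff {α : Fin q} : α ∈ theta P ↔ (P α).fst = (P α).lst :=
  (P α).isTrivialPath_iff

/-- The trivial paths are the same in all foundational linkages. -/
lemma IsFoundationalLike.verts_of_mem_theta (hQ : IsFoundationalLike W l P Q)
    (hP : IsFoundational W l P) {α : Fin q} (hα : α ∈ theta P) :
    (Q α).verts = {(P α).fst} ∧ (P α).verts = {(P α).fst} := by
  rw [mem_theta_iff] at hα
  refine ⟨?_, (P α).verts_eq_of_fst_eq_lst hα⟩
  have : (Q α).fst ∈ (Q α).verts ∩ adh W (l - 1) :=
    ⟨(Q α).fst_mem, by rw [hQ.2 α, hα]; exact hP.lst_mem α⟩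
  rw [(hQ.1.2.2.1 α).2] at this
  rw [(Q α).verts_eq_of_fst_eq_lst this, hQ.2]

/-- A trivial path is the same single vertex in `P` and `Q`, so `σ` fixes every index in `θ` and,
being injective, sends no index of `λ` there. -/
lemma IsFoundationalLike.perm_mem_lam (hQ : IsFoundationalLike W l P Q)
    (hP : IsFoundational W l P) {i : ℕ} {σ : Equiv.Perm (Fin q)}
    (hσ : ∀ α, ∃ v ∈ adh W i, v ∈ (Q α).verts ∧ v ∈ (P (σ α)).verts) {α : Fin q}
    (hα : α ∈ lam P) : σ α ∈ lam P := by
  intro hθ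
  obtain ⟨e1, e2⟩ := hQ.verts_of_mem_theta hP hθ
  obtain ⟨v, -, hvQ, hvP⟩ := hσ (σ α)
  rw [e1, ← e2] at hvQ
  have := hP.eq_of_mem hvQ hvP
  rw [← σ.injective this] at hθ
  exact hα hθ

variable [Finite V]

/-- The segment of `P γ` in the bag meets each adhesion set of the bag only in `v`, so it is
trivial, and regularity extends this to the whole path. -/
lemma IsRegular.mem_theta_of_mem_adh (h : IsRegular G W l P p) {i : ℕ} (h1 : 1 ≤ i) (hi : i < l)
    {γ : Fin q} {v : V} (hv : v ∈ (P γ).verts) (hv1 : v ∈ adh W (i - 1)) (hv2 : v ∈ adh W i) :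
    γ ∈ theta P := by
  refine h.trivial_of_restrict γ i h1 hi ?_
  obtain ⟨N, hN1, hN2, hN3, -⟩ := h.foundational.exists_segment h.slim h1 hi γ
  have hsub : N.verts ⊆ (P γ).verts := by rw [hN3]; exact Set.inter_subset_left
  have hf := h.foundational.eq_of_mem_adh h.slim (by omega) (hsub N.fst_mem) hN1 hv hv1
  have hl := h.foundational.eq_of_mem_adh h.slim hi (hsub N.lst_mem) hN2 hv hv2
  have := N.verts_eq_of_fst_eq_lst (hf.trans hl.symm)
  refine Set.ncard_eq_one.2 ⟨N.fst, ?_⟩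
  rw [← this, hN3]
  rfl

/-- The vertex of `Q α` on the second adhesion set is inner. It is on no trivial path, so the inner
bags `W 1` and `W 2` cannot have it in both of their adhesion sets; being the first vertex would
violate this for `W 1`, being the last for `W 2`. That `W 2` is inner is where `3 ≤ l` enters. -/
lemma IsFoundationalLike.exists_inner (hQ : IsFoundationalLike W l P Q)
    (h : IsRegular G W l P p) (hl : 3 ≤ l) {α : Fin q} (hα : α ∈ lam P) :
    ∃ v, v ∈ (Q α).inner := by
  obtain ⟨v, hv, hv1⟩ := hQ.1.exists_mem_adh h.slim (show 1 < l by omega) α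
  obtain ⟨γ, hγ⟩ := h.foundational.exists_of_mem_adh h.slim (show 1 < l by omega) hv1
  have key : γ ∉ theta P := by
    intro hγθ
    obtain ⟨e1, e2⟩ := hQ.verts_of_mem_theta h.foundational hγθ
    rw [e2, ← e1] at hγ
    rw [hQ.1.eq_of_mem hv hγ] at hα
    exact hα hγθ
  refine ⟨v, hv, ?_⟩
  rintro (rfl | hvl)
  · exact key (h.mem_theta_of_mem_adh le_rfl (by omega) hγ (hQ.1.fst_mem α) hv1)
  · rw [Set.mem_singleton_iff] at hvl
    have hvl' : v ∈ adh W (l - 1) := hvl ▸ hQ.1.lst_mem α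
    have : v ∈ W l := by have := hvl'.2; rwa [Nat.sub_add_cancel (by omega)] at this
    refine key (h.mem_theta_of_mem_adh (i := 2) (by omega) (by omega) hγ hv1 ⟨hv1.2, ?_⟩)
    exact h.slim.mem_of_le (i := 2) (by omega) (by omega) le_rfl hv1.2 this

/-- The linkage induced by a foundational linkage in an inner bag, enumerated as `P`. -/
lemma IsFoundational.exists_bagLinkage (hQ : IsFoundational W l Q) (h : IsSlim G W l q) {i : ℕ}
    (h1 : 1 ≤ i) (hi : i < l) (σ : Equiv.Perm (Fin q))
    (hσ : ∀ α, ∃ v ∈ adh W (i - 1), v ∈ (Q α).verts ∧ v ∈ (P (σ α)).verts) :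
    ∃ R : Fin q → DPath G, IsBagLinkage W P i R ∧ ∀ α, (R (σ α)).verts = (Q α).verts ∩ W i ∧
      (R (σ α)).graph ≤ (Q α).graph ∧ (R (σ α)).lst ∈ adh W i := by
  choose N hN1 hN2 hN3 hN4 using hQ.exists_segment h h1 hi
  have hsub : ∀ α, (N α).verts ⊆ (Q α).verts := fun α => by
    rw [hN3]; exact Set.inter_subset_left
  refine ⟨fun γ => N (σ.symm γ), ⟨⟨?_, ?_, fun γ => ⟨?_, ?_⟩, ?_⟩, fun γ => ?_⟩, fun α => ?_⟩
  · rw [h.adhesion _ (by omega), Nat.card_fin]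
  · rw [h.adhesion _ hi, Nat.card_fin]
  · ext v
    refine ⟨fun hv => ?_, ?_⟩
    · exact hQ.eq_of_mem_adh h (by omega) (hsub _ hv.1) hv.2 (hsub _ (N _).fst_mem) (hN1 _)
    · rintro rfl; exact ⟨(N _).fst_mem, hN1 _⟩
  · ext v
    refine ⟨fun hv => ?_, ?_⟩
    · exact hQ.eq_of_mem_adh h hi (hsub _ hv.1) hv.2 (hsub _ (N _).lst_mem) (hN2 _)
    · rintro rfl; exact ⟨(N _).lst_mem, hN2 _⟩
  · intro γ δ hne
    refine Set.disjoint_left.2 fun v hv hv' => hne ?_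
    exact σ.symm.injective (hQ.eq_of_mem (hsub _ hv) (hsub _ hv'))
  · obtain ⟨v, hv, hvQ, hvP⟩ := hσ (σ.symm γ)
    rw [σ.apply_symm_apply] at hvP
    rwa [hQ.eq_of_mem_adh h (by omega) (hsub _ (N (σ.symm γ)).fst_mem) (hN1 _) hvQ hv]
  · simp only [Equiv.symm_apply_apply]
    exact ⟨hN3 α, hN4 α, hN2 α⟩

/-- The paths of a foundational linkage meet an adhesion set in the same vertices as `P`, up to an
automorphism of the auxiliary graph. -/
lemma IsFoundationalLike.exists_perm (hQ : IsFoundationalLike W l P Q) (h : IsStable G W l P p)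
    {i : ℕ} (hi : i < l) : ∃ σ : Equiv.Perm (Fin q),
      (∀ α, ∃ v ∈ adh W i, v ∈ (Q α).verts ∧ v ∈ (P (σ α)).verts) ∧
      ∀ α β, (auxGraph W l P).Adj (σ α) (σ β) ↔ (auxGraph W l P).Adj α β := by
  induction i with
  | zero =>
    refine ⟨1, fun α => ⟨(Q α).fst, hQ.1.fst_mem α, (Q α).fst_mem, ?_⟩, fun _ _ => Iff.rfl⟩
    rw [hQ.2]; exact (P α).fst_mem
  | succ i ih =>
    obtain ⟨σ, hσ, hσΓ⟩ := ih (by omega)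
    -- The segments of `Q` in the next bag, relabelled by `σ`, form a linkage of that bag. Its
    -- induced permutation is an automorphism of `Γ` by `no_twist`, and composing it with `σ` gives
    -- the permutation at the next adhesion set.
    obtain ⟨R, hR, hRQ⟩ := hQ.1.exists_bagLinkage h.slim (i := i + 1) (by omega) hi σ hσ
    have hex : ∀ α, ∃ β, ∃ v ∈ adh W (i + 1), v ∈ (Q α).verts ∧ v ∈ (P β).verts := by
      intro α
      obtain ⟨v, hv, hv'⟩ := hQ.1.exists_mem_adh h.slim hi α
      obtain ⟨β, hβ⟩ := h.foundational.exists_of_mem_adh h.slim hi hv'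
      exact ⟨β, v, hv', hv, hβ⟩
    choose τ hτ using hex
    have hinj : Function.Injective τ := by
      intro α β hαβ
      obtain ⟨v, hv, hvQ, hvP⟩ := hτ α
      obtain ⟨w, hw, hwQ, hwP⟩ := hτ β
      rw [← hαβ] at hwP
      have := h.foundational.eq_of_mem_adh h.slim hi hvP hv hwP hw
      subst this
      exact hQ.1.eq_of_mem hvQ hwQ
    refine ⟨Equiv.ofBijective τ (Finite.injective_iff_bijective.1 hinj), hτ, fun α β => ?_⟩
    have hπ : IsInducedPerm P R (σ.symm.trans
        (Equiv.ofBijective τ (Finite.injective_iff_bijective.1 hinj))) := by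
      intro γ
      obtain ⟨α, rfl⟩ := σ.surjective γ
      obtain ⟨h1, h2, h3⟩ := hRQ α
      obtain ⟨v, hv, hvQ, hvP⟩ := hτ α
      have hl : (R (σ α)).lst ∈ (Q α).verts := (h1 ▸ (R (σ α)).lst_mem).1
      rw [hQ.1.eq_of_mem_adh h.slim hi hl h3 hvQ hv]
      simpa using hvP
    have := h.no_twist (i + 1) (by omega) hi R hR _ hπ (σ α) (σ β)
    simp only [Equiv.trans_apply, Equiv.symm_apply_apply] at this
    exact this.trans (hσΓ α β)

end Regular

/-! ### Bridges of linkages -/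

section Bridge

variable {G : SimpleGraph V} {S B : G.Subgraph} {x y u v : V}

lemma adj_delete_top : ((⊤ : G.Subgraph).deleteVerts S.verts).spanningCoe.Adj u v ↔
    G.Adj u v ∧ u ∉ S.verts ∧ v ∉ S.verts := by
  simp only [SimpleGraph.Subgraph.spanningCoe_adj, SimpleGraph.Subgraph.deleteVerts_adj,
    SimpleGraph.Subgraph.verts_top, Set.mem_univ, true_and, SimpleGraph.Subgraph.top_adj]
  tauto

lemma self_mem_componentAvoiding (H S : G.Subgraph) (x : V) : x ∈ componentAvoiding H S x :=
  SimpleGraph.Reachable.refl _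

lemma componentAvoiding_subset {R : Set V} (hx : x ∈ R)
    (hR : ∀ u ∈ R, ∀ w, G.Adj u w → w ∉ S.verts → w ∈ R) : componentAvoiding ⊤ S x ⊆ R := by
  rintro y ⟨p⟩
  refine walk_support_subset (T := ∅) (fun u hu w hadj _ => ?_) p hx (by simp) _ p.end_mem_support
  exact hR u hu w (adj_delete_top.1 hadj).1 (adj_delete_top.1 hadj).2.2

lemma notMem_of_mem_componentAvoiding (hx : x ∉ S.verts) (hy : y ∈ componentAvoiding ⊤ S x) :
    y ∉ S.verts :=
  componentAvoiding_subset (R := {y | y ∉ S.verts}) hx (fun _ _ _ _ h => h) hy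

lemma mem_componentAvoiding_of_adj (hx : x ∉ S.verts) (hy : y ∈ componentAvoiding ⊤ S x)
    (h : G.Adj y v) (hv : v ∉ S.verts) : v ∈ componentAvoiding ⊤ S x :=
  SimpleGraph.Reachable.trans hy
    (adj_delete_top.2 ⟨h, notMem_of_mem_componentAvoiding hx hy, hv⟩).reachable

lemma componentAvoiding_eq (hy : y ∈ componentAvoiding ⊤ S x) :
    componentAvoiding ⊤ S y = componentAvoiding ⊤ S x := by
  ext z
  exact ⟨fun h => SimpleGraph.Reachable.trans hy h,
    fun h => SimpleGraph.Reachable.trans (SimpleGraph.Reachable.symm hy) h⟩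

/-- The subgraph formed by all edges with an end in `C`. -/
def starOf (G : SimpleGraph V) (C : Set V) : G.Subgraph where
  verts := C ∪ {v | ∃ c ∈ C, G.Adj c v}
  Adj u v := G.Adj u v ∧ (u ∈ C ∨ v ∈ C)
  adj_sub h := h.1
  edge_vert := by
    rintro u v ⟨h, hu | hv⟩
    · exact .inl hu
    · exact .inr ⟨v, hv, h.symm⟩
  symm := ⟨fun _ _ h => ⟨h.1.symm, h.2.symm⟩⟩

/-- The non-trivial `S`-bridge that contains the vertex `x`. -/
def bridgeOf (S : G.Subgraph) (x : V) : G.Subgraph := starOf G (componentAvoiding ⊤ S x)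

lemma isBridge_bridgeOf (hx : x ∉ S.verts) : IsBridge ⊤ S (bridgeOf S x) :=
  .inr ⟨x, ⟨trivial, hx⟩, rfl, fun _ _ => Iff.rfl⟩

lemma mem_bridgeOf (S : G.Subgraph) (x : V) : x ∈ (bridgeOf S x).verts :=
  .inl (self_mem_componentAvoiding _ _ _)

lemma IsNontrivialBridge.exists_eq (hB : IsNontrivialBridge ⊤ S B) :
    ∃ x, x ∉ S.verts ∧ B = bridgeOf S x := by
  obtain ⟨x, hx, hv, ha⟩ := hB
  refine ⟨x, hx.2, SimpleGraph.Subgraph.ext hv ?_⟩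
  funext u v
  exact propext (ha u v)

lemma IsTrivialBridge.verts_subset (hB : IsTrivialBridge ⊤ S B) : B.verts ⊆ S.verts := by
  obtain ⟨u, v, h, hu, hv, -, rfl⟩ := hB
  rintro w (rfl | rfl) <;> assumption

/-- A bridge is determined by any of its vertices outside `S`. -/
lemma IsBridge.eq_bridgeOf (hB : IsBridge ⊤ S B) (hv : v ∈ B.verts) (hvS : v ∉ S.verts) :
    B = bridgeOf S v := by
  rcases hB with hB | hB
  · exact absurd (hB.verts_subset hv) hvS
  · obtain ⟨x, hx, rfl⟩ := hB.exists_eq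
    have hvC : v ∈ componentAvoiding ⊤ S x := by
      rcases hv with hv | ⟨c, hc, hadj⟩
      · exact hv
      · exact mem_componentAvoiding_of_adj hx hc hadj hvS
    rw [bridgeOf, bridgeOf, componentAvoiding_eq hvC]

lemma mem_iSup_graph {ι : Type*} {Q : ι → DPath G} :
    v ∈ (⨆ i, (Q i).graph).verts ↔ ∃ i, v ∈ (Q i).verts := by
  simp [SimpleGraph.Subgraph.verts_iSup, DPath.verts]

lemma adj_iSup_graph {ι : Type*} {Q : ι → DPath G} :
    (⨆ i, (Q i).graph).Adj u v ↔ ∃ i, (Q i).graph.Adj u v := by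
  simp [SimpleGraph.Subgraph.iSup_adj]

end Bridge

/-! ### Bridges inside a single bag. -/

section BagBridge

variable {G : SimpleGraph V} {W : ℕ → Set V} {l q p : ℕ} {P Q : Fin q → DPath G}

/-- The bags containing a vertex form an interval, so a vertex in two bags is in the intersection of
two consecutive ones. -/
lemma IsSlim.eq_of_mem_of_notMem_adh (h : IsSlim G W l q) {v : V} (hv : ∀ i < l, v ∉ adh W i)
    {i j : ℕ} (hi : i ≤ l) (hj : j ≤ l) (hvi : v ∈ W i) (hvj : v ∈ W j) : i = j := by
  have key : ∀ {i j : ℕ}, j ≤ l → v ∈ W i → v ∈ W j → ¬ i < j := by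
    intro i j hj hvi hvj hij
    exact hv i (by omega) ⟨hvi, h.mem_of_le (Nat.le_succ i) hij hj hvi hvj⟩
  have h1 := key hj hvi hvj
  have h2 := key hi hvj hvi
  omega

variable {S : G.Subgraph}

/-- A non-trivial bridge of a subgraph containing all adhesion sets lies in one bag. -/
lemma IsSlim.bridgeOf_le (h : IsSlim G W l q) (hS : ∀ i < l, adh W i ⊆ S.verts) {x : V}
    (hx : x ∉ S.verts) {i : ℕ} (hi : i ≤ l) (hxi : x ∈ W i) :
    bridgeOf S x ≤ inducedOn G (W i) := by
  have hstep : ∀ c, c ∉ S.verts → c ∈ W i → ∀ v, G.Adj c v → v ∈ W i := by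
    intro c hc hci v hcv
    obtain ⟨j, hj, hcj, hvj⟩ := h.cover_edge c v hcv
    rwa [h.eq_of_mem_of_notMem_adh (fun k hk hck => hc (hS k hk hck)) hi hj hci hcj]
  have hC : componentAvoiding ⊤ S x ⊆ {c | c ∉ S.verts ∧ c ∈ W i} :=
    componentAvoiding_subset ⟨hx, hxi⟩ fun u hu w hadj hw => ⟨hw, hstep u hu.1 hu.2 w hadj⟩
  have hV : (bridgeOf S x).verts ⊆ W i := by
    rintro v (hv | ⟨c, hc, hcv⟩)
    · exact (hC hv).2
    · exact hstep c (hC hc).1 (hC hc).2 v hcv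
  exact ⟨hV, fun u v huv => ⟨hV huv.fst_mem, hV huv.snd_mem, huv.adj_sub⟩⟩

/-- Every edge outside `S` with an end in no outer bag lies in an `S`-bridge in an inner bag. -/
lemma IsSlim.exists_bridge (h : IsSlim G W l q) (hS : ∀ i < l, adh W i ⊆ S.verts) {u v : V}
    (huv : G.Adj u v) (hn : ¬ S.Adj u v) (hu0 : u ∉ W 0) (hul : u ∉ W l) :
    ∃ B : G.Subgraph, IsBridge ⊤ S B ∧ (∃ i, 1 ≤ i ∧ i < l ∧ B ≤ inducedOn G (W i)) ∧ B.Adj u v ∧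
      (u ∈ S.verts → v ∈ S.verts → B.verts = {u, v}) := by
  obtain ⟨i, hi, hui, hvi⟩ := h.cover_edge u v huv
  have hi0 : 1 ≤ i := by
    rcases Nat.eq_zero_or_pos i with rfl | h
    · exact absurd hui hu0
    · exact h
  have hil : i < l := lt_of_le_of_ne hi (by rintro rfl; exact hul hui)
  by_cases hu : u ∈ S.verts
  · by_cases hv : v ∈ S.verts
    · refine ⟨G.subgraphOfAdj huv, .inl ⟨u, v, huv, hu, hv, hn, rfl⟩, ⟨i, hi0, hil, ?_⟩, ?_,
        fun _ _ => rfl⟩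
      · exact SimpleGraph.subgraphOfAdj_le_of_adj _
          (show (inducedOn G (W i)).Adj u v from ⟨hui, hvi, huv⟩)
      · simp
    · exact ⟨bridgeOf S v, isBridge_bridgeOf hv, ⟨i, hi0, hil, h.bridgeOf_le hS hv hi hvi⟩,
        ⟨huv, .inr (self_mem_componentAvoiding _ _ _)⟩, fun _ h => absurd h hv⟩
  · exact ⟨bridgeOf S u, isBridge_bridgeOf hu, ⟨i, hi0, hil, h.bridgeOf_le hS hu hi hui⟩,
      ⟨huv, .inl (self_mem_componentAvoiding _ _ _)⟩, fun h => absurd h hu⟩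

variable [Finite V]

lemma IsFoundational.adh_subset (hQ : IsFoundational W l Q) (h : IsSlim G W l q) :
    ∀ i < l, adh W i ⊆ (⨆ α, (Q α).graph).verts := fun _ hi _ hv =>
  mem_iSup_graph.2 (hQ.exists_of_mem_adh h hi hv)

/-- If a bridge in an inner bag attaches to two paths of a foundational linkage, not both trivial,
then it realises an edge of the auxiliary graph. -/
lemma IsFoundationalLike.adj_of_attaches (hQ : IsFoundationalLike W l P Q)
    (h : IsStable G W l P p) {B : G.Subgraph} (hB : IsBridge ⊤ (⨆ α, (Q α).graph) B)
    (hBi : ∃ i, 1 ≤ i ∧ i < l ∧ B ≤ inducedOn G (W i)) {α β : Fin q} (hαβ : α ≠ β)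
    (hα : α ∈ lam P) (hBα : Attaches B (Q α).graph) (hBβ : Attaches B (Q β).graph) :
    (auxGraph W l P).Adj α β := by
  obtain ⟨i, h1, hi, hBW⟩ := hBi
  obtain ⟨σ, hσ, hσΓ⟩ := hQ.exists_perm h (show i - 1 < l by omega)
  obtain ⟨R, hR, hRQ⟩ := hQ.1.exists_bagLinkage h.slim h1 hi σ hσ
  have hRS : (⨆ α, (R α).graph).verts = (⨆ α, (Q α).graph).verts ∩ W i := by
    ext v
    simp only [Set.mem_inter_iff, mem_iSup_graph]
    constructor
    · rintro ⟨γ, hγ⟩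
      obtain ⟨δ, rfl⟩ := σ.surjective γ
      rw [(hRQ δ).1] at hγ
      exact ⟨⟨δ, hγ.1⟩, hγ.2⟩
    · rintro ⟨⟨δ, hδ⟩, hv⟩
      exact ⟨σ δ, by rw [(hRQ δ).1]; exact ⟨hδ, hv⟩⟩
  have hle : (⨆ α, (R α).graph) ≤ ⨆ α, (Q α).graph := by
    refine iSup_le fun γ => ?_
    obtain ⟨δ, rfl⟩ := σ.surjective γ
    exact (hRQ δ).2.1.trans (le_iSup (fun α => (Q α).graph) δ)
  -- `R` is the trace of `Q` in the bag. All neighbours of the component of a non-trivial `B` lie in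
  -- the bag, so those on `Q` are on `R`, and passing to `R` does not enlarge the component.
  have hBR : IsBridge ⊤ (⨆ α, (R α).graph) B := by
    rcases hB with hB | hB
    · have hsub := hB.verts_subset
      obtain ⟨u, v, huv, hu, hv, hn, rfl⟩ := hB
      refine .inl ⟨u, v, huv, ?_, ?_, fun hadj => hn (hle.2 hadj), rfl⟩ <;> rw [hRS]
      · exact ⟨hu, hBW.1 (by simp)⟩
      · exact ⟨hv, hBW.1 (by simp)⟩
    · obtain ⟨x, hx, rfl⟩ := hB.exists_eq
      have hxR : x ∉ (⨆ α, (R α).graph).verts := fun hxR => hx (hle.1 hxR)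
      have hC : componentAvoiding ⊤ (⨆ α, (R α).graph) x =
          componentAvoiding ⊤ (⨆ α, (Q α).graph) x := by
        refine Set.Subset.antisymm ?_ ?_
        · refine componentAvoiding_subset (self_mem_componentAvoiding _ _ _) fun u hu w hadj hw => ?_
          refine mem_componentAvoiding_of_adj hx hu hadj fun hwQ => hw ?_
          rw [hRS]
          exact ⟨hwQ, hBW.1 (.inr ⟨u, hu, hadj⟩)⟩
        · exact componentAvoiding_subset (self_mem_componentAvoiding _ _ _) fun u hu w hadj hw =>
            mem_componentAvoiding_of_adj hxR hu hadj fun hwR => hw (hle.1 hwR)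
      rw [bridgeOf, ← hC]
      exact isBridge_bridgeOf hxR
  have hatt : ∀ {γ}, Attaches B (Q γ).graph → Attaches B (R (σ γ)).graph := by
    rintro γ ⟨v, hv, hvQ⟩
    refine ⟨v, hv, ?_⟩
    have : v ∈ (R (σ γ)).verts := by rw [(hRQ γ).1]; exact ⟨hvQ, hBW.1 hv⟩
    exact this
  rw [← hσΓ]
  exact h.no_bridging i h1 hi R hR _ _ (.inl (hQ.perm_mem_lam h.foundational hσ hα))
    ⟨fun he => hαβ (σ.injective he), B, hBR, hBW, hatt hBα, hatt hBβ⟩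

end BagBridge

/-! ### The graph `G_D^Q` of a block -/

section Part

variable {G : SimpleGraph V} {W : ℕ → Set V} {l q p : ℕ} {P Q : Fin q → DPath G}
  {D : (auxGraph W l P).Subgraph}

lemma mem_part_iff (hQ : IsFoundational W l Q) {v : V} : v ∈ (part W l P Q D).verts ↔
    (∃ α ∈ D.verts, v ∈ (Q α).verts) ∨
      ((∀ α, v ∉ (Q α).verts) ∧ ∃ B ∈ selectedBridges W l P Q D, v ∈ B.verts) := by
  have : v ∈ (part W l P Q D).verts ↔ ((∃ α, v ∈ (Q α).verts) ∨
      ∃ B ∈ selectedBridges W l P Q D, v ∈ B.verts) ∧ ∀ α, α ∉ D.verts → v ∉ (Q α).verts := by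
    simp [part, SimpleGraph.Subgraph.verts_iSup, SimpleGraph.Subgraph.verts_sSup, DPath.verts]
  rw [this]
  constructor
  · rintro ⟨h1, h2⟩
    by_cases h : ∃ α, v ∈ (Q α).verts
    · obtain ⟨α, hα⟩ := h
      exact .inl ⟨α, by_contra fun hn => h2 α hn hα, hα⟩
    · exact .inr ⟨fun α hα => h ⟨α, hα⟩, h1.resolve_left h⟩
  · rintro (⟨α, hα, hv⟩ | ⟨h1, h2⟩)
    · refine ⟨.inl ⟨α, hv⟩, fun β hβ hvβ => hβ ?_⟩
      rwa [← hQ.eq_of_mem hv hvβ]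
    · exact ⟨.inr h2, fun α _ => h1 α⟩

lemma part_adj_of_graph {u v : V} (hu : u ∈ (part W l P Q D).verts)
    (hv : v ∈ (part W l P Q D).verts) {α : Fin q} (h : (Q α).graph.Adj u v) :
    (part W l P Q D).Adj u v := by
  refine SimpleGraph.Subgraph.deleteVerts_adj.2 ⟨hu.1, hu.2, hv.1, hv.2, ?_⟩
  exact SimpleGraph.Subgraph.sup_adj.2 (.inl (adj_iSup_graph.2 ⟨α, h⟩))

lemma part_adj_of_bridge {u v : V} (hu : u ∈ (part W l P Q D).verts)
    (hv : v ∈ (part W l P Q D).verts) {B : G.Subgraph} (hB : B ∈ selectedBridges W l P Q D)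
    (h : B.Adj u v) : (part W l P Q D).Adj u v := by
  refine SimpleGraph.Subgraph.deleteVerts_adj.2 ⟨hu.1, hu.2, hv.1, hv.2, ?_⟩
  exact SimpleGraph.Subgraph.sup_adj.2 (.inr (SimpleGraph.Subgraph.sSup_adj.2 ⟨B, hB, h⟩))

lemma graph_le_part (hQ : IsFoundational W l Q) {α : Fin q} (hα : α ∈ D.verts) :
    (Q α).graph ≤ part W l P Q D := by
  have hV : (Q α).graph.verts ⊆ (part W l P Q D).verts := fun v hv =>
    (mem_part_iff hQ).2 (.inl ⟨α, hα, hv⟩)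
  exact ⟨hV, fun u v huv => part_adj_of_graph (hV huv.fst_mem) (hV huv.snd_mem) huv⟩

lemma IsBlock.verts_subset_lam (hD : IsBlock (inducedOn (auxGraph W l P) (lam P)) D) :
     D.verts ⊆ lam P := hD.1.1.1

/-- A block is an induced subgraph, so `Γ[V(D)] = D`. This lets compressedness, which speaks of a
set of indices, be applied to `G_D^Q`. -/
lemma IsBlock.part_eq_partOn (hD : IsBlock (inducedOn (auxGraph W l P) (lam P)) D) :
     part W l P Q D = partOn W l P Q D.verts := by
  have : inducedOn (auxGraph W l P) D.verts = D := by
    refine SimpleGraph.Subgraph.ext rfl ?_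
    funext α β
    refine propext ⟨fun hαβ => hD.adj_of_mem hαβ.1 hαβ.2.1
      ⟨hD.1.1.1 hαβ.1, hD.1.1.1 hαβ.2.1, hαβ.2.2⟩,
      fun hαβ => ⟨hαβ.fst_mem, hαβ.snd_mem, hαβ.adj_sub⟩⟩
  rw [partOn, this]

variable [Finite V]

lemma mem_one_of_mem_part (hQ : IsFoundational W l Q) (h : IsSlim G W l q) (hl : 0 < l) {v : V}
    (hv : v ∈ (part W l P Q D).verts) (hv0 : v ∈ W 0) : v ∈ W 1 := by
  rcases (mem_part_iff hQ).1 hv with ⟨α, -, hα⟩ | ⟨-, B, hB, hvB⟩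
  · rw [hQ.eq_fst_of_mem_zero h hl hα hv0]
    exact (hQ.fst_mem α).2
  · obtain ⟨-, ⟨i, h1, hi, hBi⟩, -⟩ := hB
    exact h.mem_of_le (Nat.zero_le 1) h1 hi.le hv0 (hBi.1 hvB)

lemma mem_pred_of_mem_part (hQ : IsFoundational W l Q) (h : IsSlim G W l q) (hl : 0 < l) {v : V}
    (hv : v ∈ (part W l P Q D).verts) (hvl : v ∈ W l) : v ∈ W (l - 1) := by
  rcases (mem_part_iff hQ).1 hv with ⟨α, -, hα⟩ | ⟨-, B, hB, hvB⟩
  · rw [hQ.eq_lst_of_mem_last h hl hα hvl]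
    exact (hQ.lst_mem α).1
  · obtain ⟨-, ⟨i, h1, hi, hBi⟩, -⟩ := hB
    exact h.mem_of_le (by omega) (Nat.sub_le l 1) le_rfl (hBi.1 hvB) hvl

lemma notMem_outer_of_mem_part (hQ : IsFoundational W l Q) (h : IsSlim G W l q) (hl : 0 < l) {v : V}
    (hv : v ∈ (part W l P Q D).verts) (hv0 : v ∉ adh W 0) (hvl : v ∉ adh W (l - 1)) :
    v ∉ W 0 ∧ v ∉ W l := by
  refine ⟨fun h0 => hv0 ⟨h0, mem_one_of_mem_part hQ h hl hv h0⟩, fun h1 => hvl ⟨?_, ?_⟩⟩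
  · exact mem_pred_of_mem_part hQ h hl hv h1
  · rwa [Nat.sub_add_cancel hl]

/-- `G_λ` contains all neighbours of a non-trivial path of `Q` that are on no trivial path. -/
lemma IsFoundationalLike.mem_partOn_lam (hQ : IsFoundationalLike W l P Q)
    (h : IsRegular G W l P p) {α : Fin q} (hα : α ∈ lam P) {u w : V} (hu : u ∈ (Q α).verts)
    (huw : G.Adj u w) (hw : ∀ β ∈ theta P, w ∉ (Q β).verts) (hu0 : u ∉ W 0) (hul : u ∉ W l) :
    w ∈ (partOn W l P P (lam P)).verts := by
  rw [partOn, mem_part_iff h.foundational]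
  have hθ : ∀ {β}, β ∈ theta P → (P β).verts = (Q β).verts := fun {β} hβ => by
    obtain ⟨e1, e2⟩ := hQ.verts_of_mem_theta h.foundational hβ
    rw [e1, e2]
  by_cases hwP : ∃ β, w ∈ (P β).verts
  · obtain ⟨β, hβ⟩ := hwP
    exact .inl ⟨β, fun hβθ => hw β hβθ (hθ hβθ ▸ hβ), hβ⟩
  have hwS : w ∉ (⨆ β, (P β).graph).verts := by rwa [mem_iSup_graph]
  push Not at hwP
  obtain ⟨i, hi, hui, hwi⟩ := h.slim.cover_edge u w huw
  have hi0 : 1 ≤ i := by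
    rcases Nat.eq_zero_or_pos i with rfl | h
    · exact absurd hui hu0
    · exact h
  have hil : i < l := lt_of_le_of_ne hi (by rintro rfl; exact hul hui)
  refine .inr ⟨hwP, bridgeOf _ w, ⟨isBridge_bridgeOf hwS, ⟨i, hi0, hil,
    h.slim.bridgeOf_le (h.foundational.adh_subset h.slim) hwS hi hwi⟩,
    .inr ⟨?_, fun β hβ => absurd hβ.1 hβ.2⟩⟩, mem_bridgeOf _ _⟩
  -- Otherwise the component of `w` attaches only to trivial paths of `P`, whose vertices `T`
  -- separate it from the common first vertex of `Q α` and `P α`. But `Q α` avoids `T` and leads to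
  -- `u`, a neighbour of `w`.
  by_contra! hcon
  set T : Set V := {v | ∃ β ∈ theta P, v ∈ (P β).verts} with hT
  have hQT : ∀ v ∈ (Q α).walk.support, v ∉ T := by
    rintro v hv ⟨β, hβ, hvβ⟩
    rw [hθ hβ] at hvβ
    rw [hQ.1.eq_of_mem (DPath.mem_verts.2 hv) hvβ] at hα
    exact hα hβ
  have hur : u ∈ reachAvoid G {(Q α).fst} T :=
    walk_support_subset_reachAvoid (Q α).walk (Set.mem_singleton _) hQT u (DPath.mem_verts.1 hu)
  have hwT : w ∉ T := fun ⟨β, _, hβ⟩ => hwP β hβ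
  have hsub : reachAvoid G {(Q α).fst} T ⊆
      {v | v ∉ componentAvoiding ⊤ (⨆ β, (P β).graph) w ∧ v ∉ T} := by
    refine reachAvoid_subset ?_ ?_
    · rintro _ rfl hT
      refine ⟨fun hC => notMem_of_mem_componentAvoiding hwS hC (mem_iSup_graph.2 ⟨α, ?_⟩), hT⟩
      rw [hQ.2]; exact (P α).fst_mem
    · rintro v ⟨hvC, hvT⟩ x hvx hxT
      refine ⟨fun hxC => ?_, hxT⟩
      have hvS : v ∈ (⨆ β, (P β).graph).verts := by
        by_contra hvS
        exact hvC (mem_componentAvoiding_of_adj hwS hxC hvx.symm hvS)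
      obtain ⟨β, hβ⟩ := mem_iSup_graph.1 hvS
      by_cases hβθ : β ∈ theta P
      · exact hvT ⟨β, hβθ, hβ⟩
      · exact hcon β ⟨hβθ, hβθ⟩ ⟨v, .inr ⟨x, hxC, hvx.symm⟩, hβ⟩
  exact (hsub (mem_reachAvoid_of_adj hur huw hwT)).1 (self_mem_componentAvoiding _ _ _)

/-- The neighbours of a vertex of `G_D^Q` outside the outer bags: they are in `G_D^Q`, or on
trivial paths in the neighbourhood of `D`, or the vertex is on a path of a cut-vertex and the
neighbour is in `G_λ`. -/
lemma IsBlock.adj_part (hD : IsBlock (inducedOn (auxGraph W l P) (lam P)) D)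
    (hQ : IsFoundationalLike W l P Q) (h : IsStable G W l P p) {u w : V}
    (hu : u ∈ (part W l P Q D).verts) (hu0 : u ∉ W 0) (hul : u ∉ W l) (huw : G.Adj u w) :
    (w ∈ (part W l P Q D).verts ∧ (part W l P Q D).Adj u w) ∨
    (∃ τ ∈ nbhd D ∩ theta P, w ∈ (Q τ).verts) ∨
    ((∃ α ∈ cutIn (lam P) D, u ∈ (Q α).verts) ∧
      w ∈ (partOn W l P P (lam P)).verts \ (part W l P Q D).verts) := by
  have hDlam := hD.verts_subset_lam
  by_cases hS : (⨆ α, (Q α).graph).Adj u w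
  · obtain ⟨α, hα⟩ := adj_iSup_graph.1 hS
    have hαD : α ∈ D.verts := by
      have huα : u ∈ (Q α).verts := hα.fst_mem
      rcases (mem_part_iff hQ.1).1 hu with ⟨β, hβ, huβ⟩ | ⟨hn, -⟩
      · rwa [hQ.1.eq_of_mem huα huβ]
      · exact absurd huα (hn α)
    have hw : w ∈ (part W l P Q D).verts := (mem_part_iff hQ.1).2 (.inl ⟨α, hαD, hα.snd_mem⟩)
    exact .inl ⟨hw, part_adj_of_graph hu hw hα⟩
  obtain ⟨B, hB, hBi, hBuw, hBv⟩ := h.slim.exists_bridge (hQ.1.adh_subset h.slim) huw hS hu0 hul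
  have hattw : ∀ {β}, w ∈ (Q β).verts → Attaches B (Q β).graph := fun hβ => ⟨w, hBuw.snd_mem, hβ⟩
  have hΓ : ∀ {α β}, α ∈ D.verts → Attaches B (Q α).graph → β ∉ D.verts →
      Attaches B (Q β).graph → (auxGraph W l P).Adj α β := fun {α β} hα hBα hβ hBβ =>
    hQ.adj_of_attaches h hB hBi (by rintro rfl; exact hβ hα) (hDlam hα) hBα hBβ
  have hN : ∀ {α β}, α ∈ D.verts → Attaches B (Q α).graph → β ∉ D.verts → w ∈ (Q β).verts →
      β ∈ theta P → ∃ τ ∈ nbhd D ∩ theta P, w ∈ (Q τ).verts := fun {α β} hα hBα hβ hw hβθ =>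
    ⟨β, ⟨⟨hβ, α, hα, hΓ hα hBα hβ (hattw hw)⟩, hβθ⟩, hw⟩
  rcases (mem_part_iff hQ.1).1 hu with ⟨α, hα, huα⟩ | ⟨hun, B', hB', huB'⟩
  · have hBα : Attaches B (Q α).graph := ⟨u, hBuw.fst_mem, huα⟩
    -- An attachment to a non-trivial path outside `D` yields an edge of `Γ[λ]` that leaves the
    -- block at `α`, so `α` is a cut-vertex.
    have hcut : ∀ {β}, β ∈ lam P → β ∉ D.verts → Attaches B (Q β).graph →
        α ∈ cutIn (lam P) D := by
      intro β hβ hβD hBβ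
      refine ⟨hα, by_contra fun hn => hβD (hD.mem_of_adj hα hn ?_)⟩
      exact ⟨hDlam hα, hβ, hΓ hα hBα hβD hBβ⟩
    by_cases hwS : ∃ β, w ∈ (Q β).verts
    · obtain ⟨β, hβ⟩ := hwS
      by_cases hβD : β ∈ D.verts
      · have hw : w ∈ (part W l P Q D).verts := (mem_part_iff hQ.1).2 (.inl ⟨β, hβD, hβ⟩)
        refine .inl ⟨hw, part_adj_of_bridge hu hw ⟨hB, hBi, .inr ⟨⟨α, ⟨hα, hDlam hα⟩, hBα⟩, ?_⟩⟩
          hBuw⟩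
        -- Both ends are on `Q`, so the bridge is the single edge `uw` and attaches to no path other
        -- than `Q α` and `Q β`.
        rintro γ ⟨-, hγ⟩ ⟨v, hv, hvγ⟩
        rw [hBv (mem_iSup_graph.2 ⟨α, huα⟩) (mem_iSup_graph.2 ⟨β, hβ⟩)] at hv
        rcases hv with rfl | rfl
        · exact hγ (hQ.1.eq_of_mem hvγ huα ▸ hα)
        · exact hγ (hQ.1.eq_of_mem hvγ hβ ▸ hβD)
      · by_cases hβθ : β ∈ theta P
        · exact .inr (.inl (hN hα hBα hβD hβ hβθ))
        · refine .inr (.inr ⟨⟨α, hcut hβθ hβD (hattw hβ), huα⟩, ?_, ?_⟩)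
          · refine hQ.mem_partOn_lam h.toIsRegular (hDlam hα) huα huw (fun γ hγ hwγ => hβθ ?_)
              hu0 hul
            rwa [hQ.1.eq_of_mem hβ hwγ]
          · intro hw
            rcases (mem_part_iff hQ.1).1 hw with ⟨γ, hγ, hwγ⟩ | ⟨hn, -⟩
            · exact hβD (hQ.1.eq_of_mem hβ hwγ ▸ hγ)
            · exact hn β hβ
    · have hwS' : w ∉ (⨆ β, (Q β).graph).verts := by rwa [mem_iSup_graph]
      have hwQ : ∀ β, w ∉ (Q β).verts := fun β hβ => hwS ⟨β, hβ⟩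
      by_cases hsel : B ∈ selectedBridges W l P Q D
      · have hw : w ∈ (part W l P Q D).verts :=
          (mem_part_iff hQ.1).2 (.inr ⟨hwQ, B, hsel, hBuw.snd_mem⟩)
        exact .inl ⟨hw, part_adj_of_bridge hu hw hsel hBuw⟩
      · have : ∃ β ∈ lam P \ D.verts, Attaches B (Q β).graph := by
          by_contra! hcon
          exact hsel ⟨hB, hBi, .inr ⟨⟨α, ⟨hα, hDlam hα⟩, hBα⟩, hcon⟩⟩
        obtain ⟨β, ⟨hβ, hβD⟩, hBβ⟩ := this
        refine .inr (.inr ⟨⟨α, hcut hβ hβD hBβ, huα⟩, ?_, ?_⟩)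
        · exact hQ.mem_partOn_lam h.toIsRegular (hDlam hα) huα huw (fun γ _ => hwQ γ) hu0 hul
        · intro hw
          rcases (mem_part_iff hQ.1).1 hw with ⟨γ, -, hwγ⟩ | ⟨-, B', hB', hwB'⟩
          · exact hwQ γ hwγ
          · refine hsel ?_
            rwa [hB.eq_bridgeOf hBuw.snd_mem hwS', ← hB'.1.eq_bridgeOf hwB' hwS']
  · have huS : u ∉ (⨆ β, (Q β).graph).verts := by rw [mem_iSup_graph]; rintro ⟨β, hβ⟩; exact hun β hβ
    have hsel : B ∈ selectedBridges W l P Q D := by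
      rwa [hB.eq_bridgeOf hBuw.fst_mem huS, ← hB'.1.eq_bridgeOf huB' huS]
    have hin : w ∈ (part W l P Q D).verts →
        w ∈ (part W l P Q D).verts ∧ (part W l P Q D).Adj u w := fun hw =>
      ⟨hw, part_adj_of_bridge hu hw hsel hBuw⟩
    by_cases hwS : ∃ β, w ∈ (Q β).verts
    · obtain ⟨β, hβ⟩ := hwS
      by_cases hβD : β ∈ D.verts
      · exact .inl (hin ((mem_part_iff hQ.1).2 (.inl ⟨β, hβD, hβ⟩)))
      · refine .inr (.inl ?_)
        by_cases hβθ : β ∈ theta P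
        · rcases hsel.2.2 with ⟨α, α', hαα', hBα, -⟩ | ⟨⟨α, hα, hBα⟩, -⟩
          · exact hN hαα'.fst_mem hBα hβD hβ hβθ
          · exact hN hα.1 hBα hβD hβ hβθ
        -- A bridge selected because it realises an edge of `D` would give `β` two neighbours in the
        -- block, forcing `β ∈ D`. The other selection rule forbids the attachment to `Q β`
        -- outright.
        · exfalso
          rcases hsel.2.2 with ⟨α, α', hαα', hBα, hBα'⟩ | ⟨-, hn⟩
          · have hα := hαα'.fst_mem
            have hα' := hαα'.snd_mem
            refine hβD (hD.mem_of_two_adj hα hα' hαα'.adj_sub.ne ?_ ?_)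
            · exact ⟨hβθ, hDlam hα, (hΓ hα hBα hβD (hattw hβ)).symm⟩
            · exact ⟨hβθ, hDlam hα', (hΓ hα' hBα' hβD (hattw hβ)).symm⟩
          · exact hn β ⟨hβθ, hβD⟩ (hattw hβ)
    · exact .inl (hin ((mem_part_iff hQ.1).2
        (.inr ⟨fun β hβ => hwS ⟨β, hβ⟩, B, hsel, hBuw.snd_mem⟩)))

end Part

/-! ### Tight separations -/

/-- A separation `(L, R)` of `H` with `A` on the left and `B` on the right. -/
structure IsSep {G : SimpleGraph V} (H : G.Subgraph) (A B L R : Set V) : Prop where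
  union : L ∪ R = H.verts
  left : A ∩ H.verts ⊆ L
  right : B ∩ H.verts ⊆ R
  adj : ∀ u v, H.Adj u v → u ∈ L ∧ v ∈ L ∨ u ∈ R ∧ v ∈ R

/-- A separation of order at most `d`. -/
def IsTight {G : SimpleGraph V} (H : G.Subgraph) (A B : Set V) (d : ℕ) (L R : Set V) : Prop :=
  IsSep H A B L R ∧ (L ∩ R).ncard ≤ d

/-- The vertices of `H` that no separation of order at most `d` separates from `x` strictly. -/
def region {G : SimpleGraph V} (H : G.Subgraph) (A B : Set V) (d : ℕ) (x : V) : Set V :=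
  {v | v ∈ H.verts ∧ ∀ L R, IsTight H A B d L R → (x ∉ L → v ∉ L) ∧ (x ∉ R → v ∉ R)}

section Sep

variable {G : SimpleGraph V} {H : G.Subgraph} {A B L R L' R' : Set V} {d : ℕ} {x : V}

lemma IsSep.swap (h : IsSep H A B L R) : IsSep H B A R L :=
  ⟨by rw [Set.union_comm, h.union], h.right, h.left, fun u v huv => (h.adj u v huv).symm⟩

lemma IsTight.swap (h : IsTight H A B d L R) : IsTight H B A d R L :=
  ⟨h.1.swap, by rw [Set.inter_comm]; exact h.2⟩

/-- Uncrossing of two separations; the opposite corner is obtained by exchanging the sides. -/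
lemma IsSep.join (h : IsSep H A B L R) (h' : IsSep H A B L' R') :
    IsSep H A B (L ∪ L') (R ∩ R') := by
  refine ⟨?_, h.left.trans Set.subset_union_left, Set.subset_inter h.right h'.right,
    fun u v huv => ?_⟩
  · have h1 := h.union
    have h2 := h'.union
    ext v
    have h1v : v ∈ L ∪ R ↔ v ∈ H.verts := by rw [h1]
    have h2v : v ∈ L' ∪ R' ↔ v ∈ H.verts := by rw [h2]
    simp only [Set.mem_union, Set.mem_inter_iff] at *
    tauto
  · have h1 := h.adj u v huv
    have h2 := h'.adj u v huv
    simp only [Set.mem_union, Set.mem_inter_iff]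
    tauto

lemma isTight_left (hA : (A ∩ H.verts).ncard ≤ d) : IsTight H A B d (A ∩ H.verts) H.verts := by
  refine ⟨⟨Set.union_eq_right.2 Set.inter_subset_right, le_rfl, Set.inter_subset_right,
    fun u v huv => .inr ⟨huv.fst_mem, huv.snd_mem⟩⟩, ?_⟩
  rwa [Set.inter_assoc, Set.inter_self]

lemma region_swap : region H A B d x = region H B A d x := by
  ext v
  exact ⟨fun h => ⟨h.1, fun L R hLR => (h.2 R L hLR.swap).symm⟩,
    fun h => ⟨h.1, fun L R hLR => (h.2 R L hLR.swap).symm⟩⟩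

lemma mem_region_self (hx : x ∈ H.verts) : x ∈ region H A B d x :=
  ⟨hx, fun _ _ _ => ⟨fun h => h, fun h => h⟩⟩

/-- If `x` were strictly on one side of the separation, its whole region would be. Thus a tight
separator can meet the region of `x` only by passing through `x` itself. -/
lemma mem_inter_of_mem_region {v : V} (hLR : IsTight H A B d L R) (hv : v ∈ L ∩ R)
    (h : v ∈ region H A B d x) : x ∈ L ∩ R :=
  ⟨by_contra fun hx => (h.2 L R hLR).1 hx hv.1, by_contra fun hx => (h.2 L R hLR).2 hx hv.2⟩

lemma notMem_left_of_mem_region (hA : (A ∩ H.verts).ncard ≤ d) (hx : x ∉ A) {v : V}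
    (hv : v ∈ region H A B d x) : v ∉ A := fun h =>
  (hv.2 _ _ (isTight_left hA)).1 (fun hx' => hx hx'.1) ⟨h, hv.1⟩

variable [Finite V]

/-- Submodularity: the orders of the two corner separations add up to at most `2d`, and the opposite
corner has order at least `d`. -/
lemma IsTight.join (hlow : ∀ L R, IsSep H A B L R → d ≤ (L ∩ R).ncard)
    (h : IsTight H A B d L R) (h' : IsTight H A B d L' R') :
    IsTight H A B d (L ∪ L') (R ∩ R') := by
  refine ⟨h.1.join h'.1, ?_⟩
  have h2 : d ≤ ((L ∩ L') ∩ (R ∪ R')).ncard := by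
    have := hlow _ _ (h.1.swap.join h'.1.swap).swap
    exact this
  have e1 := Set.ncard_union_add_ncard_inter ((L ∪ L') ∩ (R ∩ R')) ((L ∩ L') ∩ (R ∪ R'))
  have e2 := Set.ncard_union_add_ncard_inter (L ∩ R) (L' ∩ R')
  have s1 : ((L ∪ L') ∩ (R ∩ R') ∪ (L ∩ L') ∩ (R ∪ R')).ncard ≤ ((L ∩ R) ∪ (L' ∩ R')).ncard := by
    refine Set.ncard_le_ncard (fun v hv => ?_) (Set.toFinite _)
    simp only [Set.mem_union, Set.mem_inter_iff] at *
    tauto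
  have s2 : ((L ∪ L') ∩ (R ∩ R') ∩ ((L ∩ L') ∩ (R ∪ R'))).ncard ≤
      ((L ∩ R) ∩ (L' ∩ R')).ncard := by
    refine Set.ncard_le_ncard (fun v hv => ?_) (Set.toFinite _)
    simp only [Set.mem_union, Set.mem_inter_iff] at *
    tauto
  have := h.2
  have := h'.2
  omega

/-- Among the tight separations with `x` not on the left there is a rightmost one. -/
lemma exists_max_tight (hlow : ∀ L R, IsSep H A B L R → d ≤ (L ∩ R).ncard)
    (hA : (A ∩ H.verts).ncard ≤ d) (hx : x ∉ A) : ∃ L R, IsTight H A B d L R ∧ x ∉ L ∧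
      ∀ L' R', IsTight H A B d L' R' → x ∉ L' → L' ⊆ L := by
  have hne : {L : Set V | x ∉ L ∧ ∃ R, IsTight H A B d L R}.Nonempty :=
    ⟨_, fun h => hx h.1, _, isTight_left hA⟩
  obtain ⟨L, ⟨hxL, R, hLR⟩, hmax⟩ :=
    Set.exists_max_image _ Set.ncard (Set.toFinite _) hne
  refine ⟨L, R, hLR, hxL, fun L' R' hLR' hxL' => ?_⟩
  -- A left side of maximum size contains all others, as the union of two left sides that miss `x`
  -- is again one.
  have hle := hmax (L ∪ L') ⟨by simp [hxL, hxL'], _, hLR.join hlow hLR'⟩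
  have := Set.eq_of_subset_of_ncard_le (Set.subset_union_left (s := L) (t := L')) hle
    (Set.toFinite _)
  rw [this]
  exact Set.subset_union_right

/-- The region of a vertex is bounded by two tight separators. -/
lemma exists_boundary (hlow : ∀ L R, IsSep H A B L R → d ≤ (L ∩ R).ncard)
    (hA : (A ∩ H.verts).ncard ≤ d) (hB : (B ∩ H.verts).ncard ≤ d) (hxA : x ∉ A) (hxB : x ∉ B) :
    ∃ S ⊆ H.verts, S.ncard ≤ 2 * d ∧ (∀ v ∈ region H A B d x, v ∉ S) ∧
      ∀ u ∈ region H A B d x, ∀ v, H.Adj u v → v ∈ region H A B d x ∨ v ∈ S := by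
  obtain ⟨L, R, hLR, hxL, hmax⟩ := exists_max_tight (x := x) hlow hA hxA
  obtain ⟨R', L', hLR', hxR, hmax'⟩ := exists_max_tight (H := H) (A := B) (B := A) (d := d) (x := x)
    (fun L R h => by rw [Set.inter_comm]; exact hlow R L h.swap) hB hxB
  refine ⟨(L ∩ R) ∪ (L' ∩ R'), ?_, ?_, ?_, ?_⟩
  · refine Set.union_subset ?_ ?_
    · rw [← hLR.1.union]; exact Set.inter_subset_left.trans Set.subset_union_left
    · rw [← hLR'.1.union]; exact Set.inter_subset_left.trans Set.subset_union_right
  · have h1 := Set.ncard_union_le (L ∩ R) (L' ∩ R')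
    have h2 := hLR.2
    have h3 := hLR'.swap.2
    omega
  · rintro v hv (h | h)
    · exact (hv.2 _ _ hLR).1 hxL h.1
    · exact (hv.2 _ _ hLR'.swap).2 hxR h.2
  · intro u hu v huv
    have huL : u ∉ L := (hu.2 _ _ hLR).1 hxL
    have huR : u ∉ R' := (hu.2 _ _ hLR'.swap).2 hxR
    have hvR : v ∈ R := by rcases hLR.1.adj u v huv with h | h <;> tauto
    have hvL : v ∈ L' := by rcases hLR'.1.adj u v huv with h | h <;> tauto
    by_cases h1 : v ∈ L
    · exact .inr (.inl ⟨h1, hvR⟩)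
    by_cases h2 : v ∈ R'
    · exact .inr (.inr ⟨hvL, h2⟩)
    -- By maximality every tight left side that misses `x` is contained in `L`, and every such right
    -- side in `R'`; so a vertex outside both is in the region.
    exact .inl ⟨huv.snd_mem, fun L₀ R₀ h₀ =>
      ⟨fun hx hv => h1 (hmax _ _ h₀ hx hv), fun hx hv => h2 (hmax' _ _ h₀.swap hx hv)⟩⟩

end Sep

/-! ### Disjoint paths across separations. -/

section Paths

variable {G : SimpleGraph V} {H : G.Subgraph} {A B L R : Set V} {ι : Type*} [Finite ι]
  {N : ι → DPath G}

lemma IsSep.exists_mem (h : IsSep H A B L R) {N : DPath G} (hN : N.graph ≤ H)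
    (hA : N.fst ∈ A) (hB : N.lst ∈ B) : ∃ v ∈ N.verts, v ∈ L ∩ R := by
  obtain ⟨v, hv, hv'⟩ := exists_mem_inter (G := H.spanningCoe) h.adj
    (N.walk.transfer H.spanningCoe fun e he => by
      induction e with
      | h a b => exact hN.2 (SimpleGraph.Walk.adj_toSubgraph_iff_mem_edges.2 he))
    (h.left ⟨hA, hN.1 N.fst_mem⟩) (h.right ⟨hB, hN.1 N.lst_mem⟩)
  rw [SimpleGraph.Walk.support_transfer] at hv
  exact ⟨v, DPath.mem_verts.2 hv, hv'⟩

/-- Disjoint paths bound the order of a separation from below. -/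
lemma IsSep.le_ncard [Finite V] (h : IsSep H A B L R) (hd : PairwiseDisjointPaths N)
    (hN : ∀ i, (N i).graph ≤ H) (hA : ∀ i, (N i).fst ∈ A) (hB : ∀ i, (N i).lst ∈ B) :
    Nat.card ι ≤ (L ∩ R).ncard := by
  by_contra! hlt
  have := (hd.transversal (Set.toFinite (L ∩ R)) hlt.le
    fun i => h.exists_mem (hN i) (hA i) (hB i)).2.2
  omega

/-- If `H - z` does not contain `k` disjoint paths from `A` to `B`, then `z` lies on a separator
of order at most `k`. -/
lemma exists_tight_of_not_linked [Finite V] {k : ℕ} {z : V} (hz : z ∈ H.verts)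
    (hn : ¬ ∃ N : Fin k → DPath G, PairwiseDisjointPaths N ∧
      ∀ i, (N i).fst ∈ A ∧ (N i).lst ∈ B ∧ (N i).graph ≤ H.deleteVerts {z}) :
    ∃ L R, IsTight H A B k L R ∧ z ∈ L ∩ R := by
  set K := H.deleteVerts {z} with hK
  obtain ⟨S, hS, hSk⟩ : ∃ S, Separates K.spanningCoe (A ∩ K.verts) (B ∩ K.verts) S ∧
      S.ncard < k := by
    by_contra! hcon
    obtain ⟨N, hN, hNAB⟩ := exists_linkage_of_separates _ _ _ _ hcon
    refine hn ⟨fun i => (N i).mapLe K.spanningCoe_le, fun i j hij => ?_, fun i =>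
      ⟨(hNAB i).1.1, (hNAB i).2.1, mapLe_toSubgraph_le _ (hNAB i).1.2⟩⟩
    simpa only [DPath.mapLe_verts] using hN i j hij
  set X := reachAvoid K.spanningCoe (A ∩ K.verts) S with hX
  have hXK : X ⊆ K.verts := reachAvoid_subset (fun a ha _ => ha.2) fun u _ w huw _ =>
    (show K.Adj u w from huw).snd_mem
  have hstep : ∀ u v, H.Adj u v → u ∈ X → v ∈ X ∪ insert z S := by
    intro u v huv hu
    by_cases hv : v ∈ insert z S
    · exact .inr hv
    · have hadj : K.spanningCoe.Adj u v := by
        have hu' := hXK hu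
        simp only [Set.mem_insert_iff, not_or] at hv
        exact SimpleGraph.Subgraph.deleteVerts_adj.2 ⟨hu'.1, hu'.2, huv.snd_mem, hv.1, huv⟩
      exact .inl (mem_reachAvoid_of_adj hu hadj fun h => hv (Set.mem_insert_of_mem _ h))
  have hXH : X ⊆ H.verts := fun v hv => (hXK hv).1
  have hzX : z ∉ X := fun h => (hXK h).2 rfl
  -- The left side is the part reachable from `A` together with `S` and `z`. The separator is
  -- contained in `S ∪ {z}`, which has at most `k` vertices since `S` has fewer than `k`.
  refine ⟨(X ∪ insert z S) ∩ H.verts, H.verts \ X, ⟨⟨?_, ?_, ?_, ?_⟩, ?_⟩, ⟨?_, ?_⟩⟩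
  · ext v
    have := @hXH v
    simp only [Set.mem_union, Set.mem_inter_iff, Set.mem_sdiff]
    tauto
  · rintro a ⟨ha, haH⟩
    refine ⟨?_, haH⟩
    by_cases h : a ∈ insert z S
    · exact .inr h
    · simp only [Set.mem_insert_iff, not_or] at h
      exact .inl (mem_reachAvoid_of_mem ⟨ha, haH, h.1⟩ h.2)
  · rintro b ⟨hb, hbH⟩
    exact ⟨hbH, fun hbX => hS b ⟨hb, hXK hbX⟩ hbX⟩
  · intro u v huv
    by_cases hu : u ∈ X
    · exact .inl ⟨⟨.inl hu, huv.fst_mem⟩, hstep u v huv hu, huv.snd_mem⟩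
    by_cases hv : v ∈ X
    · exact .inl ⟨⟨hstep v u huv.symm hv, huv.fst_mem⟩, .inl hv, huv.snd_mem⟩
    · exact .inr ⟨⟨huv.fst_mem, hu⟩, huv.snd_mem, hv⟩
  · have hsub : (X ∪ insert z S) ∩ H.verts ∩ (H.verts \ X) ⊆ insert z S := by
      rintro v ⟨⟨h1, -⟩, -, h2⟩
      exact h1.resolve_left h2
    have h1 := Set.ncard_le_ncard hsub (Set.toFinite _)
    have h2 := Set.ncard_insert_le z S
    omega
  · exact ⟨.inr (Set.mem_insert _ _), hz⟩
  · exact ⟨hz, hzX⟩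

end Paths

/-- In a `p`-connected graph, fewer than `p` vertices do not separate `x` from `w`. -/
lemma IsKConnected.not_separated {G : SimpleGraph V} {p : ℕ} (hG : IsKConnected G p)
    {K S : Set V} {x w : V} (hx : x ∈ K) (hxS : x ∉ S) (hw : w ∉ K) (hwS : w ∉ S)
    (hK : ∀ u ∈ K, ∀ v, G.Adj u v → v ∈ K ∨ v ∈ S) : p ≤ S.ncard := by
  by_contra! hlt
  obtain ⟨q⟩ := (hG.2 S hlt).preconnected ⟨x, hxS⟩ ⟨w, hwS⟩
  have : ∀ {a b : (Sᶜ : Set V)} (_ : (G.induce Sᶜ).Walk a b), (a : V) ∈ K → (b : V) ∈ K := by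
    intro a b q ha
    induction q with
    | nil => exact ha
    | @cons u v w hadj q ih => exact ih ((hK _ ha _ hadj).resolve_right v.2)
  exact hw (this q hx)

lemma DPath.ncard_neighborSet_eq_two {G : SimpleGraph V} {P : DPath G} {v : V}
    (hv : v ∈ P.inner) : (P.graph.neighborSet v).ncard = 2 := by
  obtain ⟨h1, h2⟩ := hv
  obtain ⟨n, hn, hnl⟩ := SimpleGraph.Walk.mem_support_iff_exists_getVert.1 (DPath.mem_verts.1 h1)
  subst hn
  refine P.isPath.ncard_neighborSet_toSubgraph_internal_eq_two ?_ ?_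
  · rintro rfl
    exact h2 (.inl (by simp))
  · refine lt_of_le_of_ne hnl ?_
    rintro rfl
    exact h2 (.inr (by simp))

/-! ### Tight separators and regions in `G_D^Q` when `Q` is compressed. -/

section Compressed

variable {G : SimpleGraph V} {W : ℕ → Set V} {l q p : ℕ} {P Q : Fin q → DPath G}
  {D : (auxGraph W l P).Subgraph}

/-- The vertices on the trivial paths in the neighbourhood of `D`. -/
def trivialNbhd (Q : Fin q → DPath G) (D : (auxGraph W l P).Subgraph) : Set V :=
  {v | ∃ τ ∈ nbhd D ∩ theta P, v ∈ (Q τ).verts}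

lemma ncard_trivialNbhd_le (hQ : IsFoundationalLike W l P Q) (hP : IsFoundational W l P) :
    (trivialNbhd Q D).ncard ≤ (nbhd D ∩ theta P).ncard := by
  refine (Set.ncard_le_ncard (t := (fun τ => (P τ).fst) '' (nbhd D ∩ theta P)) ?_
    (Set.toFinite _)).trans (Set.ncard_image_le (Set.toFinite _))
  rintro v ⟨τ, hτ, hv⟩
  rw [(hQ.verts_of_mem_theta hP hτ.2).1] at hv
  exact ⟨τ, hτ, hv.symm⟩

lemma notMem_trivialNbhd (hQ : IsFoundational W l Q) {v : V}
    (hv : v ∈ (part W l P Q D).verts) : v ∉ trivialNbhd Q D := by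
  rintro ⟨τ, hτ, hvτ⟩
  rcases (mem_part_iff hQ).1 hv with ⟨α, hα, hvα⟩ | ⟨hn, -⟩
  · exact hτ.1.1 (hQ.eq_of_mem hvτ hvα ▸ hα)
  · exact hn τ hvτ

variable [Finite V]

lemma mem_path_of_mem_adh (hQ : IsFoundational W l Q) (h : IsSlim G W l q) {i : ℕ} (hi : i < l)
    {v : V} (hv : v ∈ adh W i) (hvH : v ∈ (part W l P Q D).verts) :
    ∃ α ∈ D.verts, v ∈ (Q α).verts := by
  obtain ⟨α, hα⟩ := hQ.exists_of_mem_adh h hi hv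
  rcases (mem_part_iff hQ).1 hvH with h' | ⟨hn, -⟩
  · exact h'
  · exact absurd hα (hn α)

/-- The vertices of an adhesion set are all on paths of `Q`, one on each, and only the paths indexed
by `D` survive in `G_D^Q`. -/
lemma ncard_adh_inter_le (hQ : IsFoundational W l Q) (h : IsSlim G W l q) {i : ℕ} (hi : i < l) :
    (adh W i ∩ (part W l P Q D).verts).ncard ≤ D.verts.ncard := by
  have hf : ∀ v : (adh W i ∩ (part W l P Q D).verts : Set V), ∃ α : D.verts, v.1 ∈ (Q α).verts := by
    rintro ⟨v, hv, hvH⟩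
    obtain ⟨α, hα, hvα⟩ := mem_path_of_mem_adh hQ h hi hv hvH
    exact ⟨⟨α, hα⟩, hvα⟩
  choose f hf using hf
  rw [← Nat.card_coe_set_eq, ← Nat.card_coe_set_eq]
  refine Nat.card_le_card_of_injective f fun u v huv => Subtype.ext ?_
  refine hQ.eq_of_mem_adh h hi (hf u) u.2.1 ?_ v.2.1
  rw [huv]
  exact hf v

lemma le_ncard_of_isSep (hQ : IsFoundational W l Q) {L R : Set V}
    (hLR : IsSep (part W l P Q D) (adh W 0) (adh W (l - 1)) L R) :
    D.verts.ncard ≤ (L ∩ R).ncard := by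
  rw [← Nat.card_coe_set_eq]
  exact hLR.le_ncard (N := fun α : D.verts => Q α)
    (fun α β hαβ => hQ.2.2.2 α β fun he => hαβ (Subtype.ext he))
    (fun α => graph_le_part hQ α.2) (fun α => hQ.fst_mem α) (fun α => hQ.lst_mem α)

/-- The vertices of a tight separator are on the paths `Q α` with `α ∈ D`, one on each. -/
lemma IsTight.transversal (hQ : IsFoundational W l Q) {L R : Set V}
    (hLR : IsTight (part W l P Q D) (adh W 0) (adh W (l - 1)) D.verts.ncard L R) :
    (∀ v ∈ L ∩ R, ∃ α ∈ D.verts, v ∈ (Q α).verts) ∧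
      ∀ α ∈ D.verts, ∀ u ∈ (Q α).verts, u ∈ L ∩ R → ∀ v ∈ (Q α).verts, v ∈ L ∩ R → u = v := by
  have hd : PairwiseDisjointPaths fun α : D.verts => Q α :=
    fun α β hαβ => hQ.2.2.2 α β fun he => hαβ (Subtype.ext he)
  obtain ⟨h1, h2, -⟩ := hd.transversal (Set.toFinite (L ∩ R))
    (by rw [Nat.card_coe_set_eq]; exact hLR.2)
    fun α => hLR.1.exists_mem (graph_le_part hQ α.2) (hQ.fst_mem α) (hQ.lst_mem α)
  refine ⟨fun v hv => ?_, fun α hα => h2 ⟨α, hα⟩⟩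
  obtain ⟨α, hα⟩ := h1 v hv
  exact ⟨α, α.2, hα⟩

/-- If `Q` is compressed to `D`, then every vertex of `G_D^Q` with a neighbour in `G_λ - G_D^Q` is
on a tight separator. -/
lemma IsCompressed.exists_tight (hD : IsBlock (inducedOn (auxGraph W l P) (lam P)) D)
    (hQ : IsFoundational W l Q) (h : IsSlim G W l q) (hl : 0 < l)
    (hQc : IsCompressed W l P Q D.verts) {z w : V} (hz : z ∈ (part W l P Q D).verts)
    (hw : w ∈ (partOn W l P P (lam P)).verts \ (part W l P Q D).verts) (hzw : G.Adj z w) :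
    ∃ L R, IsTight (part W l P Q D) (adh W 0) (adh W (l - 1)) D.verts.ncard L R ∧ z ∈ L ∩ R := by
  refine exists_tight_of_not_linked hz ?_
  rintro ⟨N, hN, hNAB⟩
  rw [IsCompressed, ← hD.part_eq_partOn] at hQc
  have hNH : ∀ i, (N i).verts ⊆ (part W l P Q D).verts := fun i v hv => ((hNAB i).2.2.1 hv).1
  -- The paths from Menger's theorem merely have their ends in the adhesion sets. By counting, they
  -- meet these sets nowhere else, as `IsBetween` demands.
  have hfst := (hN.fst_of_card (X := adh W 0 ∩ (part W l P Q D).verts) (Set.toFinite _)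
    (fun i => ⟨(hNAB i).1, hNH i (N i).fst_mem⟩)
    (by rw [Nat.card_fin]; exact ncard_adh_inter_le hQ h hl)).2
  have hlst := (hN.lst_of_card (X := adh W (l - 1) ∩ (part W l P Q D).verts) (Set.toFinite _)
    (fun i => ⟨(hNAB i).2.1, hNH i (N i).lst_mem⟩)
    (by rw [Nat.card_fin]; exact ncard_adh_inter_le hQ h (by omega))).2
  let e : D.verts ≃ Fin D.verts.ncard := Finite.equivFinOfCardEq (Nat.card_coe_set_eq _)
  refine hQc ⟨z, hz, ⟨fun α => N (e α), fun α β hαβ => hN _ _ fun he => hαβ (e.injective he),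
    fun α => ⟨⟨?_, ?_⟩, (hNAB _).2.2⟩⟩, w, hw, hzw⟩
  · ext v
    refine ⟨fun hv => hfst _ v hv.1 ⟨hv.2, hNH _ hv.1⟩, ?_⟩
    rintro rfl
    exact ⟨(N _).fst_mem, (hNAB _).1⟩
  · ext v
    refine ⟨fun hv => hlst _ v hv.1 ⟨hv.2, hNH _ hv.1⟩, ?_⟩
    rintro rfl
    exact ⟨(N _).lst_mem, (hNAB _).2.1⟩

/-- A set of vertices of `G_D^Q` that is separated from the rest of the graph by few vertices of
`G_D^Q` and the trivial paths in the neighbourhood of `D`. -/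
lemma IsKConnected.le_of_separated (hG : IsKConnected G p) (hQ : IsFoundationalLike W l P Q)
    (hP : IsFoundational W l P) (h : IsSlim G W l q) (hl : 0 < l) {K S : Set V}
    (hK : K ⊆ (part W l P Q D).verts) (hS : S ⊆ (part W l P Q D).verts) {x : V} (hx : x ∈ K)
    (hxS : x ∉ S) (hadj : ∀ u ∈ K, ∀ v, G.Adj u v → v ∈ K ∨ v ∈ S ∨ v ∈ trivialNbhd Q D) :
    p ≤ S.ncard + (nbhd D ∩ theta P).ncard := by
  -- A vertex of `W 0` outside `W 1` is neither in `G_D^Q` nor on a trivial neighbour, so there is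
  -- something to be separated from.
  obtain ⟨w, hw0, hw1⟩ := Set.not_subset.1 (h.antichain 0 (Nat.zero_le _) 1 hl (by omega))
  have hwH : w ∉ (part W l P Q D).verts := fun hw => hw1 (mem_one_of_mem_part hQ.1 h hl hw hw0)
  have hwT : w ∉ trivialNbhd Q D := by
    rintro ⟨τ, -, hτ⟩
    rw [hQ.1.eq_fst_of_mem_zero h hl hτ hw0] at hw1
    exact hw1 (hQ.1.fst_mem τ).2
  have := hG.not_separated (K := K) (S := S ∪ trivialNbhd Q D) (w := w) hx
    (fun hxs => hxs.elim hxS (notMem_trivialNbhd hQ.1 (hK hx))) (fun hwK => hwH (hK hwK))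
    (fun hws => hws.elim (fun hwS => hwH (hS hwS)) hwT) hadj
  exact this.trans ((Set.ncard_union_le _ _).trans
    (Nat.add_le_add_left (ncard_trivialNbhd_le hQ hP) _))

/-- If there are few trivial neighbours of `D`, then all vertices of `G_D^Q` are on tight
separators. -/
lemma IsCompressed.exists_tight_of_lt (hD : IsBlock (inducedOn (auxGraph W l P) (lam P)) D)
    (hQ : IsFoundationalLike W l P Q) (h : IsStable G W l P p) (hl : 0 < l)
    (hG : IsKConnected G p) (hQc : IsCompressed W l P Q D.verts)
    (hp : 2 * D.verts.ncard + (nbhd D ∩ theta P).ncard < p) {x : V}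
    (hx : x ∈ (part W l P Q D).verts) :
    ∃ L R, IsTight (part W l P Q D) (adh W 0) (adh W (l - 1)) D.verts.ncard L R ∧ x ∈ L ∩ R := by
  have hA := ncard_adh_inter_le (P := P) (D := D) hQ.1 h.slim hl
  have hB := ncard_adh_inter_le (P := P) (D := D) hQ.1 h.slim (show l - 1 < l by omega)
  by_cases hxA : x ∈ adh W 0
  · exact ⟨_, _, isTight_left hA, ⟨hxA, hx⟩, hx⟩
  by_cases hxB : x ∈ adh W (l - 1)
  · exact ⟨_, _, (isTight_left hB).swap, hx, hxB, hx⟩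
  by_contra hcon
  obtain ⟨S, hSH, hS, hdisj, hbd⟩ := exists_boundary (fun L R hLR => le_ncard_of_isSep hQ.1 hLR)
    hA hB hxA hxB
  have hxC := mem_region_self (A := adh W 0) (B := adh W (l - 1)) (d := D.verts.ncard) hx
  have := hG.le_of_separated hQ h.foundational h.slim hl (fun v hv => hv.1) hSH hxC (hdisj x hxC) ?_
  · omega
  intro u hu v huv
  have hu0 := notMem_left_of_mem_region hA hxA hu
  have hul := notMem_left_of_mem_region hB hxB (region_swap ▸ hu)
  obtain ⟨hu0, hul⟩ := notMem_outer_of_mem_part hQ.1 h.slim hl hu.1 hu0 hul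
  rcases hD.adj_part hQ h hu.1 hu0 hul huv with ⟨-, hH⟩ | hT | ⟨-, hw⟩
  · exact (hbd u hu v hH).imp_right .inl
  · exact .inr (.inr hT)
  -- An edge from `u` to `G_λ - G_D^Q` would put `u`, and with it `x`, on a tight separator.
  · obtain ⟨L, R, hLR, huLR⟩ := hQc.exists_tight hD hQ.1 h.slim hl hu.1 hw huv
    exact absurd ⟨L, R, hLR, mem_inter_of_mem_region hLR huLR hu⟩ hcon

/-- If there are few trivial neighbours of `D`, then `D` contains a cut-vertex of `Γ[λ]`. -/
lemma IsBlock.cutIn_nonempty (hD : IsBlock (inducedOn (auxGraph W l P) (lam P)) D)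
    (hQ : IsFoundationalLike W l P Q) (h : IsStable G W l P p) (hl : 3 ≤ l)
    (hG : IsKConnected G p) (hp : 2 * D.verts.ncard + (nbhd D ∩ theta P).ncard < p) :
    (cutIn (lam P) D).Nonempty := by
  by_contra hκ
  rw [Set.not_nonempty_iff_eq_empty] at hκ
  have hA := ncard_adh_inter_le (P := P) (D := D) hQ.1 h.slim (show 0 < l by omega)
  have hB := ncard_adh_inter_le (P := P) (D := D) hQ.1 h.slim (show l - 1 < l by omega)
  obtain ⟨α, hα⟩ := hD.1.2.1.nonempty
  obtain ⟨x, hxQ, hx⟩ := hQ.exists_inner h.toIsRegular hl (hD.verts_subset_lam hα)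
  have hxA : x ∉ adh W 0 := fun hxA =>
    hx (.inl (hQ.1.eq_fst_of_mem_zero h.slim (by omega) hxQ hxA.1))
  have hxB : x ∉ adh W (l - 1) := fun hxB => hx (.inr
    (hQ.1.eq_of_mem_adh h.slim (by omega) hxQ hxB (Q α).lst_mem (hQ.1.lst_mem α)))
  set H := part W l P Q D with hH
  have hxH : x ∈ H.verts := (graph_le_part hQ.1 hα).1 hxQ
  -- Without cut-vertices in `D`, the inside of `G_D^Q` can only be left through the two end
  -- adhesion sets, each with at most `|D|` vertices in `G_D^Q`, and through trivial neighbours.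
  have := hG.le_of_separated (D := D) (K := H.verts \ (adh W 0 ∪ adh W (l - 1)))
    (S := adh W 0 ∩ H.verts ∪ adh W (l - 1) ∩ H.verts) hQ h.foundational h.slim (by omega)
    (fun v hv => hv.1) (Set.union_subset Set.inter_subset_right Set.inter_subset_right)
    (x := x) ⟨hxH, fun hx => hx.elim hxA hxB⟩ (fun hx => hx.elim (fun h => hxA h.1) fun h => hxB h.1)
    ?_
  · have := Set.ncard_union_le (adh W 0 ∩ H.verts) (adh W (l - 1) ∩ H.verts)
    omega
  rintro u ⟨hu, hun⟩ v huv
  simp only [Set.mem_union, not_or] at hun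
  obtain ⟨hu0, hul⟩ := notMem_outer_of_mem_part hQ.1 h.slim (by omega) hu hun.1 hun.2
  rcases hD.adj_part hQ h hu hu0 hul huv with ⟨hv, -⟩ | hT | ⟨⟨β, hβ, -⟩, -⟩
  · by_cases h1 : v ∈ adh W 0
    · exact .inr (.inl (.inl ⟨h1, hv⟩))
    by_cases h2 : v ∈ adh W (l - 1)
    · exact .inr (.inl (.inr ⟨h2, hv⟩))
    exact .inl ⟨hv, fun h => h.elim h1 h2⟩
  · exact .inr (.inr hT)
  · rw [hκ] at hβ
    exact absurd hβ (Set.notMem_empty _)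

/-- If `D` has few neighbours, then the region of an inner vertex of a path that belongs to no
cut-vertex contains many vertices of high degree on the paths of the cut-vertices. -/
lemma IsBlock.ncard_lt_region (hD : IsBlock (inducedOn (auxGraph W l P) (lam P)) D)
    (hQ : IsFoundationalLike W l P Q) (h : IsStable G W l P p) (hl : 0 < l)
    (hG : IsKConnected G p) (hp : 2 * D.verts.ncard + (nbhd D).ncard < p) {β : Fin q}
    (hβ : β ∈ D.verts) (hβκ : β ∉ cutIn (lam P) D) {x : V} (hx : x ∈ (Q β).inner) :
    (cutIn (lam P) D).ncard < (highDegree Q (cutIn (lam P) D) (part W l P Q D) ∩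
      region (part W l P Q D) (adh W 0) (adh W (l - 1)) D.verts.ncard x).ncard := by
  set H := part W l P Q D with hH
  set κ := cutIn (lam P) D with hκ
  set C := region H (adh W 0) (adh W (l - 1)) D.verts.ncard x with hC
  set U := highDegree Q κ H with hU
  have hA := ncard_adh_inter_le (P := P) (D := D) hQ.1 h.slim hl
  have hB := ncard_adh_inter_le (P := P) (D := D) hQ.1 h.slim (show l - 1 < l by omega)
  obtain ⟨hxQ, hx⟩ := hx
  have hxA : x ∉ adh W 0 := fun hxA =>
    hx (.inl (hQ.1.eq_fst_of_mem_zero h.slim (by omega) hxQ hxA.1))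
  have hxB : x ∉ adh W (l - 1) := fun hxB => hx (.inr
    (hQ.1.eq_of_mem_adh h.slim (by omega) hxQ hxB (Q β).lst_mem (hQ.1.lst_mem β)))
  have hCA : ∀ v ∈ C, v ∉ adh W 0 := fun v hv => notMem_left_of_mem_region hA hxA hv
  have hCB : ∀ v ∈ C, v ∉ adh W (l - 1) := fun v hv =>
    notMem_left_of_mem_region hB hxB (by rw [region_swap]; exact hv)
  obtain ⟨S, hSH, hS, hdisj, hbd⟩ := exists_boundary (fun L R hLR => le_ncard_of_isSep hQ.1 hLR)
    hA hB hxA hxB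
  have hxC : x ∈ C := mem_region_self ((graph_le_part hQ.1 hβ).1 hxQ)
  have hxκ : ∀ α ∈ κ, x ∉ (Q α).verts := fun α hα hxα =>
    hβκ (hQ.1.eq_of_mem hxQ hxα ▸ hα)
  -- Removing the paths of cut-vertices from the region removes all edges to `G_λ - G_D^Q`. The
  -- vertices of those paths that lie in the region and are adjacent to the rest belong to `U`.
  have hsep := hG.le_of_separated (D := D) (K := {v | v ∈ C ∧ ∀ α ∈ κ, v ∉ (Q α).verts})
    (S := S ∪ (U ∩ C)) hQ h.foundational h.slim hl (fun v hv => hv.1.1)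
    (Set.union_subset hSH fun v hv => hv.2.1) (x := x) ⟨hxC, hxκ⟩ ?_ ?_
  -- The separator has at most `2|D| + |U ∩ C| + |N(D) ∩ θ|` vertices, whereas `p > 2|D| + |N(D)| ≥
  -- 2|D| + |κ| + |N(D) ∩ θ|`.
  · have h1 := Set.ncard_union_le S (U ∩ C)
    have h2 : (nbhd D ∩ lam P).ncard + (nbhd D ∩ theta P).ncard ≤ (nbhd D).ncard := by
      rw [← Set.ncard_union_eq (Set.disjoint_left.2 fun v hv hv' => hv.2 hv'.2) (Set.toFinite _)
        (Set.toFinite _)]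
      exact Set.ncard_le_ncard (Set.union_subset Set.inter_subset_left Set.inter_subset_left)
        (Set.toFinite _)
    have h3 : κ.ncard ≤ (nbhd D ∩ lam P).ncard := ncard_cutIn_le hD
    omega
  · rintro (hxS | hxU)
    · exact hdisj x hxC hxS
    · obtain ⟨⟨⟨α, hα, hxα⟩, -⟩, -⟩ := hxU
      exact hxκ α hα hxα.1
  rintro u ⟨hu, huκ⟩ v huv
  obtain ⟨hu0, hul⟩ := notMem_outer_of_mem_part hQ.1 h.slim hl hu.1 (hCA u hu) (hCB u hu)
  rcases hD.adj_part hQ h hu.1 hu0 hul huv with ⟨-, hadj⟩ | hT | ⟨⟨α, hα, huα⟩, -⟩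
  · rcases hbd u hu v hadj with hv | hv
    · by_cases hvκ : ∃ α ∈ κ, v ∈ (Q α).verts
      · obtain ⟨α, hα, hvα⟩ := hvκ
        have hin : v ∈ (Q α).inner := by
          refine ⟨hvα, ?_⟩
          rintro (rfl | hvl)
          · exact hCA _ hv (hQ.1.fst_mem α)
          · rw [Set.mem_singleton_iff] at hvl
            exact hCB v hv (hvl ▸ hQ.1.lst_mem α)
        refine .inr (.inl (.inr ⟨⟨⟨α, hα, hin⟩, ?_⟩, hv⟩))
        -- The vertex `u` is a third neighbour of `v`, besides its two neighbours on `Q α`.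
        have hnot : u ∉ (Q α).graph.neighborSet v := fun hn =>
          huκ α hα (SimpleGraph.Subgraph.Adj.snd_mem hn)
        have hcard := Set.ncard_insert_of_notMem hnot (Set.toFinite _)
        rw [DPath.ncard_neighborSet_eq_two hin] at hcard
        refine hcard.ge.trans (Set.ncard_le_ncard (Set.insert_subset hadj.symm fun w hw =>
          (graph_le_part hQ.1 hα.1).2 hw) (Set.toFinite _))
      · push Not at hvκ
        exact .inl ⟨hv, hvκ⟩
    · exact .inr (.inl (.inl hv))
  · exact .inr (.inr hT)
  · exact absurd huα (huκ α hα)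

end Compressed

end StableDecomp

/-! ### The two statements, and the double count of high-degree vertices. -/

theorem mainTheorem9 {V : Type*} [Finite V] (G : SimpleGraph V) (p l q : ℕ) (hl : 3 ≤ l)
    (hG : StableDecomp.IsKConnected G p)
    (W : ℕ → Set V) (P : Fin q → StableDecomp.DPath G)
    (hWP : StableDecomp.IsStable G W l P p)
    (D : (StableDecomp.auxGraph W l P).Subgraph)
    (hD : StableDecomp.IsBlock
      (StableDecomp.inducedOn (StableDecomp.auxGraph W l P) (StableDecomp.lam P)) D)
    (κ : Set (Fin q)) (hκ : κ = StableDecomp.cutIn (StableDecomp.lam P) D)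
    (Q : Fin q → StableDecomp.DPath G)
    (hQ : StableDecomp.IsFoundationalLike W l P Q)
    (hQc : StableDecomp.IsCompressed W l P Q D.verts)
    (U : Set V) (hU : U = StableDecomp.highDegree Q κ (StableDecomp.part W l P Q D)) :
    (p ≤ 2 * D.verts.ncard + (StableDecomp.nbhd D ∩ StableDecomp.theta P).ncard ∨
      ((StableDecomp.part W l P Q D).verts = ⋃ α ∈ D.verts, (Q α).verts) ∧ κ.Nonempty) ∧
    (p ≤ 2 * D.verts.ncard + (StableDecomp.nbhd D).ncard ∨
      ∃ α ∈ κ, ∀ β ∈ D.verts \ κ, (Q β).verts.ncard ≤ (U ∩ (Q α).verts).ncard + 1) := by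
  classical
  open StableDecomp in
  constructor
  · refine or_iff_not_imp_left.2 fun hp => ?_
    rw [not_le] at hp
    refine ⟨?_, hκ ▸ hD.cutIn_nonempty hQ hWP hl hG hp⟩
    ext v
    simp only [Set.mem_iUnion, exists_prop]
    constructor
    · intro hv
      obtain ⟨L, R, hLR, hvLR⟩ := hQc.exists_tight_of_lt hD hQ hWP (by omega) hG hp hv
      exact (hLR.transversal hQ.1).1 v hvLR
    · rintro ⟨α, hα, hv⟩
      exact (graph_le_part hQ.1 hα).1 hv
  · refine or_iff_not_imp_left.2 fun hp => ?_
    rw [not_le] at hp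
    have hp' : 2 * D.verts.ncard + (nbhd D ∩ theta P).ncard < p :=
      lt_of_le_of_lt (Nat.add_le_add_left
        (Set.ncard_le_ncard Set.inter_subset_left (Set.toFinite _)) _) hp
    -- The path of a cut-vertex with the most vertices of `U`; by (i) there is a cut-vertex.
    obtain ⟨α, hα, hmax⟩ := Set.exists_max_image κ (fun α => (U ∩ (Q α).verts).ncard)
      (Set.toFinite _) (hκ ▸ hD.cutIn_nonempty hQ hWP hl hG hp')
    refine ⟨α, hα, fun β hβ => ?_⟩
    by_contra! hlt
    obtain ⟨x₀, hx₀⟩ := hQ.exists_inner hWP.toIsRegular hl (hD.verts_subset_lam hβ.1)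
    set C := region (part W l P Q D) (adh W 0) (adh W (l - 1)) D.verts.ncard with hC
    have hlow : ∀ x ∈ (Q β).inner, κ.ncard + 1 ≤ (U ∩ C x).ncard := fun x hx => by
      subst hκ hU
      exact hD.ncard_lt_region hQ hWP (by omega) hG hp hβ.1 hβ.2 hx
    -- A common vertex of two regions is on a tight separator, by (i). That separator would contain
    -- both `x` and `y`, but it meets `Q β` only once.
    have hdisj : ∀ x ∈ (Q β).inner, ∀ y ∈ (Q β).inner, x ≠ y → Disjoint (C x) (C y) := by
      intro x hx y hy hxy
      refine Set.disjoint_left.2 fun v hvx hvy => hxy ?_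
      obtain ⟨L, R, hLR, hvLR⟩ := hQc.exists_tight_of_lt hD hQ hWP (by omega) hG hp' hvx.1
      exact (hLR.transversal hQ.1).2 β hβ.1 x hx.1 (mem_inter_of_mem_region hLR hvLR hvx) y hy.1
        (mem_inter_of_mem_region hLR hvLR hvy)
    have hUup : U.ncard ≤ κ.ncard * (U ∩ (Q α).verts).ncard := by
      have hsub : (Set.toFinite U).toFinset ⊆ (Set.toFinite κ).toFinset.biUnion
          fun γ => (Set.toFinite (U ∩ (Q γ).verts)).toFinset := by
        intro v hv
        rw [Set.Finite.mem_toFinset] at hv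
        obtain ⟨γ, hγ, hvγ⟩ := (hU ▸ hv).1
        simp only [Finset.mem_biUnion, Set.Finite.mem_toFinset]
        exact ⟨γ, hγ, hv, hvγ.1⟩
      have h1 := (Finset.card_le_card hsub).trans (Finset.card_biUnion_le_card_mul _ _
        (U ∩ (Q α).verts).ncard fun γ hγ => by
          rw [← Set.ncard_eq_toFinset_card]
          exact hmax γ ((Set.Finite.mem_toFinset _).1 hγ))
      rwa [← Set.ncard_eq_toFinset_card, ← Set.ncard_eq_toFinset_card] at h1
    have hUlow : (Q β).inner.ncard * (κ.ncard + 1) ≤ U.ncard := by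
      have hsub : (Set.toFinite (Q β).inner).toFinset.biUnion
          (fun x => (Set.toFinite (U ∩ C x)).toFinset) ⊆ (Set.toFinite U).toFinset := by
        intro v hv
        simp only [Finset.mem_biUnion, Set.Finite.mem_toFinset] at hv ⊢
        obtain ⟨x, -, hv, -⟩ := hv
        exact hv
      have h1 := Finset.card_le_card hsub
      rw [Finset.card_biUnion] at h1
      · have h2 := Finset.card_nsmul_le_sum (Set.toFinite (Q β).inner).toFinset
          (fun x => (Set.toFinite (U ∩ C x)).toFinset.card) (κ.ncard + 1) fun x hx => by
            rw [← Set.ncard_eq_toFinset_card]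
            exact hlow x ((Set.Finite.mem_toFinset _).1 hx)
        rw [smul_eq_mul, ← Set.ncard_eq_toFinset_card] at h2
        rw [← Set.ncard_eq_toFinset_card U] at h1
        exact h2.trans h1
      · intro x hx y hy hxy
        rw [Finset.mem_coe, Set.Finite.mem_toFinset] at hx hy
        refine Finset.disjoint_left.2 fun v hv hv' => ?_
        rw [Set.Finite.mem_toFinset] at hv hv'
        exact Set.disjoint_left.1 (hdisj x hx y hy hxy) hv.2 hv'.2
    have hinner : (Q β).verts.ncard ≤ (Q β).inner.ncard + 2 := by
      have h1 := Set.ncard_le_ncard_sdiff_add_ncard (Q β).verts {(Q β).fst, (Q β).lst}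
        (Set.toFinite _)
      exact h1.trans (Nat.add_le_add_left ((Set.ncard_insert_le _ _).trans (by simp)) _)
    have hpos : 0 < (Q β).inner.ncard := (Set.ncard_pos (Set.toFinite _)).2 ⟨x₀, hx₀⟩
    -- If the bound fails, then `|Q β| ≥ |U ∩ Q α| + 2`, so discarding the two ends leaves `n ≥ |U ∩
    -- Q α|` inner vertices. The two counts of `U` give `n (|κ| + 1) ≤ |κ| n`, which is impossible
    -- for `n > 0`.
    have h1 : (U ∩ (Q α).verts).ncard ≤ (Q β).inner.ncard := by omega
    have h2 := Nat.mul_le_mul_left κ.ncard h1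
    have h3 : (Q β).inner.ncard * (κ.ncard + 1) =
      κ.ncard * (Q β).inner.ncard + (Q β).inner.ncard := by ring
    omega
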